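/- Let $0<p<\infty$ and $\alpha>0$. Let $\mathcal F^p_\alpha$ be the space of entire functions $f$ with $$\|f\|_{(p,\alpha)}^p=\frac{\alpha p}{2\pi}\int_{\mathbb C}|f(z)|^p e^{-\frac{\alpha p}{2}|z|^2}\,dm(z)<\infty,$$ where $m$ is Lebesgue measure on $\mathbb C$, and let $\mathcal F^\infty_\alpha$ be the space of entire functions $f$ with $$\|f\|_{(\infty,\alpha)}=\sup_{z\in\mathbb C}|f(z)|e^{-\frac{\alpha}{2}|z|^2}<\infty.$$ Let $g$ and $\psi$ be entire functions on $\mathbb C$, and put $V_gf(z)=\int_0^z f(w)g'(w)\,dw$ and $C_\psi f=f\circ\psi$. An operator $T:\mathcal F^\infty_\alpha\to\mathcal F^p_\alpha$ is called compact if, for every sequence $(f_n)$ bounded in $\mathcal F^\infty_\alpha$, the sequence $(Tf_n)$ has a subsequence that converges in $\mathcal F^p_\alpha$. (i) The following are equivalent: $V_g:\mathcal F^\infty_\alpha\to\mathcal F^p_\alpha$ is bounded; $V_g:\mathcal F^\infty_\alpha\to\mathcal F^p_\alpha$ is compact; either $g$ is constant, or $p>2$ and $g(z)=az+b$ for some $a,b\in\mathbb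 C$. (ii) The following are equivalent: $C_\psi:\mathcal F^\infty_\alpha\to\mathcal F^p_\alpha$ is bounded; $C_\psi:\mathcal F^\infty_\alpha\to\mathcal F^p_\alpha$ is compact; $\psi(z)=az+b$ for some $a,b\in\mathbb C$ with $|a|<1$. -/

import Mathlib

open MeasureTheory Filter Topology
open scoped ENNReal NNReal

/-- The quasi-norm `‖f‖_(p,α)` for `0 < p < ∞`:
`‖f‖_(p,α)^p = (α p / 2π) ∫ |f(z)|^p exp(-(α p / 2) |z|²) dm(z)`, with values in `[0, ∞]`. -/
noncomputable def fockNorm (α p : ℝ) (f : ℂ → ℂ) : ℝ≥0∞ :=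
  (ENNReal.ofReal (α * p / (2 * Real.pi)) *
    ∫⁻ z : ℂ, ENNReal.ofReal (‖f z‖ ^ p * Real.exp (-(α * p / 2) * ‖z‖ ^ 2))) ^ (1 / p)

/-- The norm `‖f‖_(∞,α) = sup_z |f(z)| exp(-(α / 2) |z|²)`, with values in `[0, ∞]`. -/
noncomputable def fockSupNorm (α : ℝ) (f : ℂ → ℂ) : ℝ≥0∞ :=
  ⨆ z : ℂ, ENNReal.ofReal (‖f z‖ * Real.exp (-(α / 2) * ‖z‖ ^ 2))

/-- The Fock space `F^p_α`, `0 < p < ∞`: the entire functions with finite `(p,α)`-norm. -/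
def FockSpace (α p : ℝ) : Set (ℂ → ℂ) :=
  {f | Differentiable ℂ f ∧ fockNorm α p f < ∞}

/-- The growth space `F^∞_α`: the entire functions with finite `(∞,α)`-norm. -/
def FockSupSpace (α : ℝ) : Set (ℂ → ℂ) :=
  {f | Differentiable ℂ f ∧ fockSupNorm α f < ∞}

/-- The Volterra type integral operator `V_g f(z) = ∫_0^z f(w) g'(w) dw`,
the integral being taken along the segment `w = t z`, `0 ≤ t ≤ 1`. -/
noncomputable def volterraOp (g f : ℂ → ℂ) : ℂ → ℂ :=
  fun z => ∫ t in (0 : ℝ)..1, f (t * z) * deriv g (t * z) * z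

/-- The composition operator `C_ψ f = f ∘ ψ`. -/
def compOp (ψ f : ℂ → ℂ) : ℂ → ℂ := fun z => f (ψ z)

/-- `T` is a bounded operator from `F^∞_α` to `F^p_α` (in particular it maps the first
space into the second one). It is applied to linear operators only. -/
def IsBoundedFock (α p : ℝ) (T : (ℂ → ℂ) → ℂ → ℂ) : Prop :=
  (∀ f ∈ FockSupSpace α, T f ∈ FockSpace α p) ∧
    ∃ C : ℝ≥0, ∀ f ∈ FockSupSpace α, fockNorm α p (T f) ≤ C * fockSupNorm α f

/-- `T` is a compact operator from `F^∞_α` to `F^p_α`: it maps the first space into the second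
one, and the image of every norm-bounded sequence has a subsequence that converges in `F^p_α`.
(For `p < 1` the target is only quasi-normed; the sequential definition covers all `p > 0`.) -/
def IsCompactFock (α p : ℝ) (T : (ℂ → ℂ) → ℂ → ℂ) : Prop :=
  (∀ f ∈ FockSupSpace α, T f ∈ FockSpace α p) ∧
    ∀ (f : ℕ → ℂ → ℂ) (M : ℝ≥0),
      (∀ n, f n ∈ FockSupSpace α ∧ fockSupNorm α (f n) ≤ M) →
        ∃ h ∈ FockSpace α p, ∃ φ : ℕ → ℕ, StrictMono φ ∧
          Tendsto (fun n => fockNorm α p (T (f (φ n)) - h)) atTop (𝓝 0)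

/-! Necessity uses only that the operator maps the growth space into `FockSpace α p`, so one
argument serves boundedness and compactness. The theta function of the square lattice yields
functions whose weighted modulus is lattice-periodic, and finitely many translates together reach a
fixed multiple of exp(α|z|²/2) at every point (`exists_finset_extremal`). Testing on these and
summing turns the mapping property into an integral condition.

For C_ψ the condition is integrability of exp((αp/2)(|ψ|² - |z|²)). A Gaussian-weighted mean value
inequality upgrades it to a bound on |ψ(z)|² - |z|², so ψ is affine by Liouville, and a slope of
modulus at least 1 would keep the integrand above 1 on a half-plane. For V_g, the derivative
estimate `norm_deriv_rpow_le_localMass` loses a factor 1 + α|z| and shows that (|g'|/(1 + α|z|))^p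
has a majorant both bounded and integrable. Boundedness makes g' affine, integrability makes it
constant, and a nonzero constant forces p > 2.

Sufficiency rests on `isBoundedFock_and_isCompactFock`: a pointwise majorant of finite norm gives
boundedness, and together with a normal families argument and dominated convergence it gives
compactness. For V_g the majorant comes from the gain 1/(1 + |z|) in `mul_integral_exp_le`, which
matches the loss above. -/

/-! ### Subharmonicity and mean value inequalities -/

/-- Jensen's inequality: `log ‖F‖` is at most its average over a circle around the point. -/
theorem log_norm_le_circleAverage {F : ℂ → ℂ} (hF : Differentiable ℂ F) {c : ℂ} (hc : F c ≠ 0)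
    (R : ℝ) : Real.log ‖F c‖ ≤ Real.circleAverage (fun z => Real.log ‖F z‖) c R := by
  rcases eq_or_ne R 0 with rfl | hR
  · simp
  have hA : AnalyticOnNhd ℂ F (Metric.closedBall c |R|) := fun z _ => hF.analyticAt z
  rw [hA.circleAverage_log_norm hR hc]
  refine le_add_of_nonneg_left (finsum_nonneg fun u => ?_)
  by_cases hu : u ∈ Metric.closedBall c |R|
  · refine mul_nonneg ?_ ?_
    · exact_mod_cast MeromorphicOn.AnalyticOnNhd.divisor_nonneg hA u
    · rcases eq_or_ne c u with rfl | hcu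
      · simp
      rw [← Real.log_abs, abs_mul, abs_inv, abs_norm, ← div_eq_mul_inv]
      have h1 : 0 < ‖c - u‖ := norm_pos_iff.2 (sub_ne_zero.2 hcu)
      refine Real.log_nonneg ((one_le_div h1).2 ?_)
      rw [Metric.mem_closedBall, dist_comm, dist_eq_norm] at hu
      exact hu
  · rw [Function.locallyFinsuppWithin.apply_eq_zero_of_notMem _ hu]
    simp

/-- This is the tangent line of exp at 1, evaluated at p log y; equality holds at y = e^{1/p}. It
passes from log-subharmonicity to p-th powers. -/
theorem exp_one_mul_log_le_rpow {p y : ℝ} (hp : 0 < p) (hy : 0 ≤ y) :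
    Real.exp 1 * (p * Real.log y) ≤ y ^ p := by
  rcases hy.eq_or_lt with rfl | hy
  · simp [Real.zero_rpow hp.ne']
  have h := Real.add_one_le_exp (p * Real.log y - 1)
  rw [Real.exp_sub, le_div_iff₀ (Real.exp_pos 1)] at h
  rw [Real.rpow_def_of_pos hy, mul_comm (Real.log y)]
  linarith

theorem circleIntegrable_norm_rpow {F : ℂ → ℂ} (hF : Continuous F) {p : ℝ} (hp : 0 < p) (c : ℂ)
    (R : ℝ) : CircleIntegrable (fun z => ‖F z‖ ^ p) c R :=
  (hF.norm.rpow_const fun _ => Or.inr hp.le).continuousOn.circleIntegrable'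

/-- The function `‖F‖ ^ p` is subharmonic for every `p > 0`. -/
theorem norm_rpow_le_circleAverage {F : ℂ → ℂ} (hF : Differentiable ℂ F) {p : ℝ} (hp : 0 < p)
    (c : ℂ) (R : ℝ) : ‖F c‖ ^ p ≤ Real.circleAverage (fun z => ‖F z‖ ^ p) c R := by
  by_cases hc : F c = 0
  · rw [hc, norm_zero, Real.zero_rpow hp.ne']
    exact Real.circleAverage_nonneg_of_nonneg fun _ _ => by positivity
  have hc' : 0 < ‖F c‖ := norm_pos_iff.2 hc
  -- Rescaling moves the value at the centre to modulus e^{1/p}, the equality case of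
  -- `exp_one_mul_log_le_rpow`, so nothing is lost there.
  set κ : ℂ := ((Real.exp p⁻¹ / ‖F c‖ : ℝ) : ℂ) with hκ
  have hκn : ‖κ‖ = Real.exp p⁻¹ / ‖F c‖ := by
    rw [hκ, Complex.norm_real, Real.norm_of_nonneg (by positivity)]
  have hκ0 : 0 < ‖κ‖ := by rw [hκn]; positivity
  have hG : Differentiable ℂ (fun z => κ * F z) := hF.const_mul κ
  have hGc : ‖κ * F c‖ = Real.exp p⁻¹ := by
    rw [norm_mul, hκn]; field_simp
  have h1 := log_norm_le_circleAverage hG (c := c) (mul_ne_zero (norm_pos_iff.1 hκ0) hc) R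
  have hlogint : CircleIntegrable (fun z => Real.log ‖κ * F z‖) c R :=
    MeromorphicOn.circleIntegrable_log_norm fun z _ => (hG.analyticAt z).meromorphicAt
  have h2 : Real.circleAverage ((Real.exp 1 * p) • fun z => Real.log ‖κ * F z‖) c R
      ≤ Real.circleAverage (‖κ‖ ^ p • fun z => ‖F z‖ ^ p) c R := by
    refine Real.circleAverage_mono (hlogint.const_smul)
      ((circleIntegrable_norm_rpow hF.continuous hp c R).const_smul) fun z _ => ?_
    have := exp_one_mul_log_le_rpow hp (norm_nonneg (κ * F z))
    simp only [Pi.smul_apply, smul_eq_mul]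
    rw [← Real.mul_rpow (norm_nonneg _) (norm_nonneg _), ← norm_mul]
    linarith
  rw [Real.circleAverage_smul, Real.circleAverage_smul, smul_eq_mul, smul_eq_mul] at h2
  rw [hGc, Real.log_exp] at h1
  have h3 : Real.exp 1 ≤ ‖κ‖ ^ p * Real.circleAverage (fun z => ‖F z‖ ^ p) c R := by
    refine le_trans ?_ h2
    have := mul_le_mul_of_nonneg_left h1 (by positivity : 0 ≤ Real.exp 1 * p)
    rwa [mul_assoc, mul_inv_cancel₀ hp.ne', mul_one] at this
  have h4 : ‖κ‖ ^ p * ‖F c‖ ^ p = Real.exp 1 := by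
    rw [← Real.mul_rpow (norm_nonneg _) (norm_nonneg _), ← norm_mul, hGc, ← Real.exp_mul,
      inv_mul_cancel₀ hp.ne']
  rw [← h4] at h3
  exact le_of_mul_le_mul_left h3 (by positivity)

theorem lintegral_eq_lintegral_circleMap {f : ℂ → ℝ≥0∞} (hf : Measurable f) :
    ∫⁻ z, f z = ∫⁻ r in Set.Ioi (0 : ℝ), ENNReal.ofReal r *
      ∫⁻ θ in Set.Ioo (-Real.pi) Real.pi, f (circleMap 0 r θ) := by
  have hcm : Continuous fun q : ℝ × ℝ => circleMap 0 q.1 q.2 := by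
    unfold circleMap; fun_prop
  have hm : Measurable fun q : ℝ × ℝ => ENNReal.ofReal q.1 * f (circleMap 0 q.1 q.2) :=
    (ENNReal.measurable_ofReal.comp measurable_fst).mul (hf.comp hcm.measurable)
  rw [← Complex.lintegral_comp_polarCoord_symm, polarCoord_target, Measure.volume_eq_prod,
    ← Measure.prod_restrict]
  have h : ∀ q : ℝ × ℝ, ENNReal.ofReal q.1 • f (Complex.polarCoord.symm q)
      = ENNReal.ofReal q.1 * f (circleMap 0 q.1 q.2) := fun q => by
    rw [smul_eq_mul, Complex.polarCoord_symm_apply, circleMap_zero, Complex.exp_mul_I]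
    push_cast
    rfl
  simp_rw [h]
  rw [lintegral_prod _ hm.aemeasurable]
  refine lintegral_congr fun r => ?_
  exact lintegral_const_mul (ENNReal.ofReal r)
    (hf.comp (hcm.comp (by fun_prop : Continuous fun θ : ℝ => (r, θ))).measurable)

theorem lintegral_norm_eq {φ : ℝ → ℝ≥0∞} (hφ : Measurable φ) :
    ∫⁻ z : ℂ, φ ‖z‖ = ∫⁻ r in Set.Ioi (0 : ℝ), ENNReal.ofReal r *
      (ENNReal.ofReal (2 * Real.pi) * φ r) := by
  rw [lintegral_eq_lintegral_circleMap (f := fun z => φ ‖z‖) (hφ.comp measurable_norm)]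
  refine setLIntegral_congr_fun measurableSet_Ioi fun r hr => ?_
  have : ∀ θ, ‖circleMap 0 r θ‖ = r := fun θ => by
    rw [norm_circleMap_zero, abs_of_pos hr]
  simp only [this, setLIntegral_const, Real.volume_Ioo]
  rw [mul_comm (φ r)]
  ring_nf

theorem ofReal_norm_rpow_mul_le_lintegral_circleMap {F : ℂ → ℂ} (hF : Differentiable ℂ F) {p : ℝ}
    (hp : 0 < p) (c : ℂ) (r : ℝ) :
    ENNReal.ofReal (‖F c‖ ^ p) * ENNReal.ofReal (2 * Real.pi) ≤
      ∫⁻ θ in Set.Ioo (-Real.pi) Real.pi, ENNReal.ofReal (‖F (c + circleMap 0 r θ)‖ ^ p) := by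
  have h := norm_rpow_le_circleAverage hF hp c r
  rw [Real.circleAverage_eq_integral_add (-Real.pi)] at h
  rw [intervalIntegral.integral_comp_add_right (fun θ => ‖F (circleMap c r θ)‖ ^ p)] at h
  have hcont : Continuous fun θ => ‖F (circleMap c r θ)‖ ^ p :=
    (hF.continuous.comp (continuous_circleMap c r)).norm.rpow_const fun _ => Or.inr hp.le
  have e1 : (0 : ℝ) + -Real.pi = -Real.pi := by ring
  have e2 : 2 * Real.pi + -Real.pi = Real.pi := by ring
  have hpi := Real.pi_pos
  rw [e1, e2, smul_eq_mul, ← div_eq_inv_mul, le_div_iff₀ (by positivity),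
    intervalIntegral.integral_of_le (by linarith), ← integral_Ioc_eq_integral_Ioo.symm] at h
  rw [← ENNReal.ofReal_mul (by positivity)]
  refine (ENNReal.ofReal_le_ofReal h).trans_eq ?_
  rw [ofReal_integral_eq_lintegral_ofReal]
  · refine lintegral_congr fun θ => ?_
    simp [circleMap]
  · exact (hcont.integrableOn_Icc (a := -Real.pi) (b := Real.pi)).mono_set Set.Ioo_subset_Icc_self
  · exact Eventually.of_forall fun θ => by positivity

/-- The mean value inequality for `‖F‖ ^ p` with respect to a radial weight. -/
theorem ofReal_norm_rpow_mul_lintegral_le {F : ℂ → ℂ} (hF : Differentiable ℂ F) {p : ℝ}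
    (hp : 0 < p) (c : ℂ) {φ : ℝ → ℝ≥0∞} (hφ : Measurable φ) :
    ENNReal.ofReal (‖F c‖ ^ p) * ∫⁻ z : ℂ, φ ‖z‖ ≤
      ∫⁻ z : ℂ, ENNReal.ofReal (‖F (c + z)‖ ^ p) * φ ‖z‖ := by
  have hcont : Continuous fun z => ‖F (c + z)‖ ^ p :=
    (hF.continuous.comp (continuous_const.add continuous_id)).norm.rpow_const
      fun _ => Or.inr hp.le
  have hm : Measurable fun z => ENNReal.ofReal (‖F (c + z)‖ ^ p) :=
    ENNReal.measurable_ofReal.comp hcont.measurable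
  rw [lintegral_norm_eq hφ, lintegral_eq_lintegral_circleMap
      (f := fun z => ENNReal.ofReal (‖F (c + z)‖ ^ p) * φ ‖z‖) (hm.mul (hφ.comp measurable_norm)),
    ← lintegral_const_mul]
  · refine setLIntegral_mono' measurableSet_Ioi fun r hr => ?_
    have : ∀ θ, ‖circleMap 0 r θ‖ = r := fun θ => by
      rw [norm_circleMap_zero, abs_of_pos hr]
    simp only [this]
    have h : Measurable fun θ => ENNReal.ofReal (‖F (c + circleMap 0 r θ)‖ ^ p) :=
      hm.comp (continuous_circleMap 0 r).measurable
    rw [lintegral_mul_const _ h]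
    calc _ = ENNReal.ofReal r *
            (ENNReal.ofReal (‖F c‖ ^ p) * ENNReal.ofReal (2 * Real.pi) * φ r) := by ring
      _ ≤ _ := by
          gcongr
          exact ofReal_norm_rpow_mul_le_lintegral_circleMap hF hp c r
  · exact ENNReal.measurable_ofReal.mul (measurable_const.mul hφ)

/-! ### Extremal functions from the theta function -/

/-- At z = 0, τ = i the series is a sum of the positive reals exp(-πn²). -/
theorem jacobiTheta₂_zero_I_ne_zero : jacobiTheta₂ 0 Complex.I ≠ 0 := by
  intro h0
  have h := Complex.hasSum_re (hasSum_jacobiTheta₂_term 0 (τ := Complex.I) (by simp))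
  have ht : ∀ n : ℤ, (jacobiTheta₂_term n 0 Complex.I).re = Real.exp (-(Real.pi * n ^ 2)) := by
    intro n
    have : jacobiTheta₂_term n 0 Complex.I = ((Real.exp (-(Real.pi * n ^ 2)) : ℝ) : ℂ) := by
      rw [jacobiTheta₂_term]
      push_cast
      congr 1
      linear_combination (Real.pi : ℂ) * n ^ 2 * Complex.I_mul_I
    rw [this, Complex.ofReal_re]
  simp_rw [ht, h0, Complex.zero_re] at h
  have := (hasSum_zero_iff_of_nonneg fun n => (Real.exp_pos _).le).1 h
  exact (Real.exp_pos _).ne' (congrFun this 0)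

/-- The modulus of the theta function of the lattice `ℤ + iℤ`, weighted so that it is doubly
periodic. -/
noncomputable def thetaModulus (w : ℂ) : ℝ :=
  ‖jacobiTheta₂ w Complex.I‖ * Real.exp (-(Real.pi * w.im ^ 2))

theorem thetaModulus_add_one (w : ℂ) : thetaModulus (w + 1) = thetaModulus w := by
  simp [thetaModulus, jacobiTheta₂_add_left]

/-- The quasi-periodicity factor has modulus exp(π(1 + 2 Im w)), which is exactly what the Gaussian
in Im w loses under the shift. -/
theorem thetaModulus_add_I (w : ℂ) : thetaModulus (w + Complex.I) = thetaModulus w := by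
  rw [thetaModulus, thetaModulus, jacobiTheta₂_add_left', norm_mul, Complex.norm_exp,
    mul_right_comm, ← Real.exp_add, mul_comm]
  congr 2
  simp
  ring

theorem thetaModulus_add_lattice (w : ℂ) (m n : ℤ) :
    thetaModulus (w + m + n * Complex.I) = thetaModulus w := by
  have h1 : Function.Periodic thetaModulus 1 := thetaModulus_add_one
  have h2 : Function.Periodic thetaModulus Complex.I := thetaModulus_add_I
  have h1' := h1.int_mul m
  have h2' := h2.int_mul n
  rw [h2' _]
  simpa using h1' w

theorem continuous_thetaModulus : Continuous thetaModulus := by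
  have : Differentiable ℂ fun w => jacobiTheta₂ w Complex.I :=
    fun w => differentiableAt_jacobiTheta₂_fst w (by simp)
  have := this.continuous
  unfold thetaModulus
  fun_prop

theorem exists_mem_square_add_lattice (w : ℂ) :
    ∃ w₀ ∈ Set.Icc (0 : ℝ) 1 ×ℂ Set.Icc (0 : ℝ) 1, ∃ m n : ℤ, w = w₀ + m + n * Complex.I := by
  refine ⟨⟨Int.fract w.re, Int.fract w.im⟩, ?_, ⌊w.re⌋, ⌊w.im⌋, ?_⟩
  · rw [Complex.mem_reProdIm]
    exact ⟨⟨Int.fract_nonneg _, (Int.fract_lt_one _).le⟩,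
      ⟨Int.fract_nonneg _, (Int.fract_lt_one _).le⟩⟩
  · apply Complex.ext <;> simp

theorem isCompact_square : IsCompact (Set.Icc (0 : ℝ) 1 ×ℂ Set.Icc (0 : ℝ) 1) :=
  isCompact_Icc.reProdIm isCompact_Icc

theorem exists_thetaModulus_le : ∃ M, ∀ w, thetaModulus w ≤ M := by
  obtain ⟨M, hM⟩ := isCompact_square.bddAbove_image continuous_thetaModulus.continuousOn
  refine ⟨M, fun w => ?_⟩
  obtain ⟨w₀, h₀, m, n, rfl⟩ := exists_mem_square_add_lattice w
  rw [thetaModulus_add_lattice]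
  exact hM ⟨w₀, h₀, rfl⟩

/-- The translate by a is bounded below near a, because theta does not vanish at 0. Compactness of
the period square leaves finitely many a, and periodicity covers the plane. -/
theorem exists_finset_le_thetaModulus_sub :
    ∃ (t : Finset ℂ) (c : ℝ), 0 < c ∧ ∀ w, ∃ a ∈ t, c ≤ thetaModulus (w - a) := by
  have h0 : 0 < thetaModulus 0 :=
    mul_pos (norm_pos_iff.2 jacobiTheta₂_zero_I_ne_zero) (Real.exp_pos _)
  obtain ⟨t, -, ht⟩ := isCompact_square.elim_nhds_subcover
    (fun a => {w | thetaModulus 0 / 2 < thetaModulus (w - a)}) fun a _ => by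
      refine (isOpen_lt continuous_const
        (continuous_thetaModulus.comp (continuous_id.sub continuous_const))).mem_nhds ?_
      simp [h0]
  refine ⟨t, thetaModulus 0 / 2, by positivity, fun w => ?_⟩
  obtain ⟨w₀, h₀, m, n, rfl⟩ := exists_mem_square_add_lattice w
  obtain ⟨a, hat, ha⟩ := Set.mem_iUnion₂.1 (ht h₀)
  refine ⟨a, hat, ?_⟩
  rw [show w₀ + m + n * Complex.I - a = w₀ - a + m + n * Complex.I by ring,
    thetaModulus_add_lattice]
  exact le_of_lt ha

/-- The translate by `a / s`, `s = √(α / π)`, of the theta function normalized for the weight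
`exp (-(α / 2) |z|²)`. -/
noncomputable def fockTheta (α : ℝ) (a z : ℂ) : ℂ :=
  jacobiTheta₂ ((√(α / Real.pi) : ℝ) * z - a) Complex.I *
    Complex.exp (Real.pi / 2 * ((√(α / Real.pi) : ℝ) * z - a) ^ 2 +
      Real.pi * (starRingEnd ℂ a * ((√(α / Real.pi) : ℝ) * z) - starRingEnd ℂ a * a / 2))

theorem differentiable_fockTheta (α : ℝ) (a : ℂ) : Differentiable ℂ (fockTheta α a) := by
  have : Differentiable ℂ fun w => jacobiTheta₂ w Complex.I :=
    fun w => differentiableAt_jacobiTheta₂_fst w (by simp)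
  have h : Differentiable ℂ fun z : ℂ => jacobiTheta₂ ((√(α / Real.pi) : ℝ) * z - a) Complex.I :=
    this.comp (by fun_prop : Differentiable ℂ fun z : ℂ => ((√(α / Real.pi) : ℝ) : ℂ) * z - a)
  unfold fockTheta
  fun_prop

/-- With s = √(α/π) and u = sz - a, one has Re u² = |u|² - 2(Im u)². The terms in the conjugate of a
correct |u|² to s²|z|², and πs² = α. -/
theorem norm_fockTheta_mul_exp {α : ℝ} (hα : 0 < α) (a z : ℂ) :
    ‖fockTheta α a z‖ * Real.exp (-(α / 2) * ‖z‖ ^ 2) =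
      thetaModulus ((√(α / Real.pi) : ℝ) * z - a) := by
  have hs : √(α / Real.pi) ^ 2 * Real.pi = α := by
    rw [Real.sq_sqrt (by positivity)]
    field_simp
  rw [fockTheta, thetaModulus, norm_mul, Complex.norm_exp, mul_assoc, ← Real.exp_add]
  congr 2
  rw [← hs, Complex.sq_norm, Complex.normSq_apply]
  simp [pow_two]
  ring

theorem fockTheta_mem {α : ℝ} (hα : 0 < α) (a : ℂ) : fockTheta α a ∈ FockSupSpace α := by
  refine ⟨differentiable_fockTheta α a, ?_⟩
  obtain ⟨M, hM⟩ := exists_thetaModulus_le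
  refine lt_of_le_of_lt (iSup_le fun z => ENNReal.ofReal_le_ofReal ?_)
    (ENNReal.ofReal_lt_top (r := M))
  rw [norm_fockTheta_mul_exp hα]
  exact hM _

/-- Finitely many functions of `F^∞_α` attain its growth rate at every point of the plane. -/
theorem exists_finset_extremal {α : ℝ} (hα : 0 < α) :
    ∃ (t : Finset ℂ) (c : ℝ), 0 < c ∧ ∀ z : ℂ, ∃ a ∈ t,
      c ≤ ‖fockTheta α a z‖ * Real.exp (-(α / 2) * ‖z‖ ^ 2) := by
  obtain ⟨t, c, hc, h⟩ := exists_finset_le_thetaModulus_sub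
  refine ⟨t, c, hc, fun z => ?_⟩
  obtain ⟨a, ha, h'⟩ := h ((√(α / Real.pi) : ℝ) * z)
  exact ⟨a, ha, by rwa [norm_fockTheta_mul_exp hα]⟩

theorem exists_finset_extremal_rpow {α p : ℝ} (hα : 0 < α) (hp : 0 < p) :
    ∃ (t : Finset ℂ) (c : ℝ), 0 < c ∧ ∀ w : ℂ, ∃ a ∈ t,
      c * Real.exp (α * p / 2 * ‖w‖ ^ 2) ≤ ‖fockTheta α a w‖ ^ p := by
  obtain ⟨t, c, hc, h⟩ := exists_finset_extremal hα
  refine ⟨t, c ^ p, by positivity, fun w => ?_⟩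
  obtain ⟨a, ha, h'⟩ := h w
  refine ⟨a, ha, ?_⟩
  have h2 := Real.rpow_le_rpow hc.le h' hp.le
  rw [Real.mul_rpow (norm_nonneg _) (Real.exp_pos _).le, ← Real.exp_mul] at h2
  calc c ^ p * Real.exp (α * p / 2 * ‖w‖ ^ 2)
      ≤ ‖fockTheta α a w‖ ^ p * Real.exp (-(α / 2) * ‖w‖ ^ 2 * p)
          * Real.exp (α * p / 2 * ‖w‖ ^ 2) := by gcongr
    _ = ‖fockTheta α a w‖ ^ p := by
      rw [mul_assoc, ← Real.exp_add,
        show -(α / 2) * ‖w‖ ^ 2 * p + α * p / 2 * ‖w‖ ^ 2 = 0 by ring, Real.exp_zero, mul_one]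

/-! ### Finiteness of norms, a Liouville theorem and sets of infinite area -/

theorem fockNorm_lt_top_iff {α p : ℝ} (hα : 0 < α) (hp : 0 < p) {f : ℂ → ℂ} :
    fockNorm α p f < ∞ ↔
      ∫⁻ z : ℂ, ENNReal.ofReal (‖f z‖ ^ p * Real.exp (-(α * p / 2) * ‖z‖ ^ 2)) < ∞ := by
  have hk : 0 < α * p / (2 * Real.pi) := by positivity
  rw [fockNorm, ENNReal.rpow_lt_top_iff_of_pos (by positivity)]
  constructor
  · intro h
    exact ENNReal.lt_top_of_mul_ne_top_right h.ne (by simpa using hk)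
  · exact fun h => ENNReal.mul_lt_top ENNReal.ofReal_lt_top h

/-- An entire function of at most linear growth is affine. -/
theorem exists_affine_of_norm_le {h : ℂ → ℂ} (hh : Differentiable ℂ h) {A B : ℝ} (hA : 0 ≤ A)
    (hB : 0 ≤ B) (hle : ∀ z, ‖h z‖ ≤ A + B * ‖z‖) : ∃ a b : ℂ, ∀ z, h z = a * z + b := by
  have hd : ∀ z, ‖deriv h z‖ ≤ A + 2 * B := by
    intro z
    have hz : 0 < 1 + ‖z‖ := by positivity
    -- A radius comparable to the growth of h makes the Cauchy estimate for h' uniform in z.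
    have := Complex.norm_deriv_le_of_forall_mem_sphere_norm_le (c := z) (R := 1 + ‖z‖)
      (C := (A + 2 * B) * (1 + ‖z‖)) hz hh.diffContOnCl fun w hw => by
        have hw' : ‖w‖ ≤ 1 + 2 * ‖z‖ := by
          have h1 : ‖w - z‖ = 1 + ‖z‖ := by simpa [dist_eq_norm] using hw
          have h2 := norm_add_le (w - z) z
          rw [sub_add_cancel] at h2
          linarith
        have := mul_le_mul_of_nonneg_left hw' hB
        nlinarith [hle w, mul_nonneg hA (norm_nonneg z)]
    rwa [mul_div_cancel_right₀ _ hz.ne'] at this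
  have hdd : Differentiable ℂ (deriv h) := fun z => (hh.analyticAt z).deriv.differentiableAt
  have hb : Bornology.IsBounded (Set.range (deriv h)) :=
    isBounded_iff_forall_norm_le.2 ⟨A + 2 * B, by rintro _ ⟨z, rfl⟩; exact hd z⟩
  refine ⟨deriv h 0, h 0, fun z => ?_⟩
  have hk : Differentiable ℂ fun z => h z - deriv h 0 * z := by fun_prop
  have := is_const_of_deriv_eq_zero hk (fun w => by
    have h1 : HasDerivAt (fun z => h z - deriv h 0 * z) (deriv h w - deriv h 0 * 1) w :=
      (hh w).hasDerivAt.sub ((hasDerivAt_id w).const_mul _)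
    rw [h1.deriv, hdd.apply_eq_apply_of_bounded hb w 0]
    ring) z 0
  simp only [mul_zero, sub_zero] at this
  rw [← this]
  ring

theorem volume_univ_complex : volume (Set.univ : Set ℂ) = ∞ :=
  measure_univ_of_isAddLeftInvariant volume

theorem lintegral_eq_top_of_le {f : ℂ → ℝ≥0∞} {S : Set ℂ} (hS : MeasurableSet S)
    (hvol : volume S = ∞) {ε : ℝ≥0∞} (hε : ε ≠ 0) (h : ∀ z ∈ S, ε ≤ f z) : ∫⁻ z, f z = ∞ := by
  refine top_unique ?_
  calc (∞ : ℝ≥0∞) = ∫⁻ _ in S, ε := by rw [setLIntegral_const, hvol, ENNReal.mul_top hε]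
    _ ≤ ∫⁻ z in S, f z := setLIntegral_mono' hS h
    _ ≤ ∫⁻ z, f z := setLIntegral_le_lintegral _ _

theorem volume_compl_ball (R : ℝ) : volume (Metric.ball (0 : ℂ) R)ᶜ = ∞ := by
  rw [measure_compl measurableSet_ball measure_ball_lt_top.ne, volume_univ_complex,
    ENNReal.top_sub measure_ball_lt_top.ne]

/-- The set and its reflection cover the plane and have equal area. The degenerate case c = 0 is
included, since it arises for ψ(0) = 0. -/
theorem volume_half_plane (c : ℂ) : volume {z : ℂ | 0 ≤ (c * z).re} = ∞ := by
  by_contra hfin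
  have h1 : volume (-{z : ℂ | 0 ≤ (c * z).re}) = volume {z : ℂ | 0 ≤ (c * z).re} :=
    Measure.measure_neg _ _
  have h2 : (Set.univ : Set ℂ) ⊆ {z : ℂ | 0 ≤ (c * z).re} ∪ -{z : ℂ | 0 ≤ (c * z).re} := by
    intro z _
    rcases le_total 0 (c * z).re with h | h
    · exact Or.inl h
    · right
      change 0 ≤ (c * -z).re
      rw [mul_neg, Complex.neg_re]
      linarith
  have h3 := (measure_mono h2).trans (measure_union_le (μ := volume) _ _)
  rw [h1, volume_univ_complex, top_le_iff, ENNReal.add_eq_top] at h3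
  tauto

/-! ### Necessity for the composition operator -/

theorem lintegral_exp_lt_top_of_compOp_mem {α p : ℝ} (hα : 0 < α) (hp : 0 < p) {ψ : ℂ → ℂ}
    (hψ : Differentiable ℂ ψ) (hT : ∀ f ∈ FockSupSpace α, compOp ψ f ∈ FockSpace α p) :
    ∫⁻ z, ENNReal.ofReal (Real.exp (α * p / 2 * (‖ψ z‖ ^ 2 - ‖z‖ ^ 2))) < ∞ := by
  obtain ⟨t, c, hc, h⟩ := exists_finset_extremal_rpow hα hp
  have hfin : ∀ a ∈ t, ∫⁻ z, ENNReal.ofReal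
      (‖fockTheta α a (ψ z)‖ ^ p * Real.exp (-(α * p / 2) * ‖z‖ ^ 2)) < ∞ := fun a _ =>
    (fockNorm_lt_top_iff hα hp).1 (hT _ (fockTheta_mem hα a)).2
  have hmeas : ∀ a ∈ t, Measurable fun z => ENNReal.ofReal
      (‖fockTheta α a (ψ z)‖ ^ p * Real.exp (-(α * p / 2) * ‖z‖ ^ 2)) := fun a _ => by
    have h1 : Continuous fun z => ‖fockTheta α a (ψ z)‖ ^ p :=
      ((differentiable_fockTheta α a).continuous.comp hψ.continuous).norm.rpow_const
        fun _ => Or.inr hp.le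
    exact (ENNReal.continuous_ofReal.comp (h1.mul (by fun_prop))).measurable
  have hle : ENNReal.ofReal c *
      ∫⁻ z, ENNReal.ofReal (Real.exp (α * p / 2 * (‖ψ z‖ ^ 2 - ‖z‖ ^ 2))) ≤
      ∑ a ∈ t, ∫⁻ z, ENNReal.ofReal
        (‖fockTheta α a (ψ z)‖ ^ p * Real.exp (-(α * p / 2) * ‖z‖ ^ 2)) := by
    rw [← lintegral_const_mul' _ _ ENNReal.ofReal_ne_top, ← lintegral_finsetSum _ hmeas]
    refine lintegral_mono fun z => ?_
    obtain ⟨a, ha, h'⟩ := h (ψ z)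
    refine le_trans ?_ (Finset.single_le_sum (fun _ _ => zero_le) ha)
    rw [← ENNReal.ofReal_mul hc.le]
    refine ENNReal.ofReal_le_ofReal ?_
    rw [mul_sub, sub_eq_add_neg, Real.exp_add, ← mul_assoc, ← neg_mul]
    gcongr
  exact ENNReal.lt_top_of_mul_ne_top_right (hle.trans_lt (ENNReal.sum_lt_top.2 hfin)).ne
    (by simpa using hc)

/-- Integrability becomes boundedness by a mean value inequality at each z: below the integrand, and
touching it at z, lies a Gaussian in ζ - z times |H|^p with H entire. -/
theorem exists_norm_sq_le_of_lintegral_exp_lt_top {α p : ℝ} (hα : 0 < α) (hp : 0 < p) {ψ : ℂ → ℂ}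
    (hψ : Differentiable ℂ ψ)
    (hI : ∫⁻ z, ENNReal.ofReal (Real.exp (α * p / 2 * (‖ψ z‖ ^ 2 - ‖z‖ ^ 2))) < ∞) :
    ∃ C, 0 ≤ C ∧ ∀ z, ‖ψ z‖ ^ 2 ≤ ‖z‖ ^ 2 + C := by
  set I := ∫⁻ z, ENNReal.ofReal (Real.exp (α * p / 2 * (‖ψ z‖ ^ 2 - ‖z‖ ^ 2))) with hIdef
  set φ : ℝ → ℝ≥0∞ := fun r => ENNReal.ofReal (Real.exp (-(α * p / 2) * r ^ 2)) with hφ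
  have hφc : Continuous φ := ENNReal.continuous_ofReal.comp (by fun_prop)
  set A := ∫⁻ z : ℂ, φ ‖z‖ with hA
  have hA0 : A ≠ 0 := by
    intro h0
    rw [hA, lintegral_eq_zero_iff (f := fun z : ℂ => φ ‖z‖)
      (hφc.comp continuous_norm).measurable] at h0
    have h1 : ∀ᵐ z : ℂ, False := h0.mono fun z hz => by
      have : φ ‖z‖ ≠ 0 := by simp [hφ, Real.exp_pos]
      exact this hz
    have h2 : (volume : Measure ℂ) = 0 := by simpa using h1
    have h3 := volume_univ_complex
    simp [h2] at h3
  have key : ∀ z, ENNReal.ofReal (Real.exp (α * p / 2 * (‖ψ z‖ ^ 2 - ‖z‖ ^ 2))) * A ≤ I := by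
    intro z
    -- The exponent linearizes at z: |ψ(ζ)|² is replaced by its tangent lower bound 2 Re(conj ψ(z)
    -- ψ(ζ)) - |ψ(z)|², and |ζ|² by its expansion about z without |ζ - z|², which goes into the
    -- weight φ.
    set H : ℂ → ℂ := fun ζ => Complex.exp (α / 2 * (2 * starRingEnd ℂ (ψ z) * ψ ζ
      - (‖ψ z‖ ^ 2 : ℝ) - (‖z‖ ^ 2 : ℝ) - 2 * starRingEnd ℂ z * (ζ - z))) with hH
    have hHd : Differentiable ℂ H := by fun_prop
    have hHn : ∀ ζ, ‖H ζ‖ ^ p = Real.exp (α * p / 2 * (2 * (starRingEnd ℂ (ψ z) * ψ ζ).re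
        - ‖ψ z‖ ^ 2 - ‖z‖ ^ 2 - 2 * (starRingEnd ℂ z * (ζ - z)).re)) := by
      intro ζ
      rw [hH, Complex.norm_exp, ← Real.exp_mul]
      congr 1
      simp [Complex.mul_re, Complex.mul_im, -Complex.ofReal_pow]
      ring
    have h1 := ofReal_norm_rpow_mul_lintegral_le hHd hp z hφc.measurable
    have hz : ‖H z‖ ^ p = Real.exp (α * p / 2 * (‖ψ z‖ ^ 2 - ‖z‖ ^ 2)) := by
      rw [hHn]
      congr 2
      rw [Complex.sq_norm, Complex.sq_norm, Complex.normSq_apply, Complex.normSq_apply]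
      simp [Complex.mul_re]
      ring
    rw [hz] at h1
    refine h1.trans ?_
    refine le_of_le_of_eq (lintegral_mono fun ζ => ?_) (lintegral_add_left_eq_self
      (fun ζ => ENNReal.ofReal (Real.exp (α * p / 2 * (‖ψ ζ‖ ^ 2 - ‖ζ‖ ^ 2)))) z)
    rw [hφ, hHn]
    simp only
    rw [← ENNReal.ofReal_mul (Real.exp_pos _).le, ← Real.exp_add]
    refine ENNReal.ofReal_le_ofReal (Real.exp_le_exp.2 ?_)
    have e1 : 2 * (starRingEnd ℂ (ψ z) * ψ (z + ζ)).re - ‖ψ z‖ ^ 2 ≤ ‖ψ (z + ζ)‖ ^ 2 := by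
      rw [Complex.sq_norm, Complex.sq_norm, Complex.normSq_apply, Complex.normSq_apply]
      simp only [Complex.mul_re, Complex.conj_re, Complex.conj_im]
      nlinarith [sq_nonneg ((ψ z).re - (ψ (z + ζ)).re), sq_nonneg ((ψ z).im - (ψ (z + ζ)).im)]
    have e2 : ‖z + ζ‖ ^ 2 = ‖z‖ ^ 2 + 2 * (starRingEnd ℂ z * (z + ζ - z)).re + ‖ζ‖ ^ 2 := by
      simp only [Complex.sq_norm, Complex.normSq_apply]
      simp [Complex.mul_re]
      ring
    have e3 : 0 < α * p / 2 := by positivity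
    nlinarith [mul_le_mul_of_nonneg_left e1 e3.le]
  have hK : I / A ≠ ∞ := (ENNReal.div_lt_top hI.ne hA0).ne
  set K := (I / A).toReal
  have hlog : ∀ z, α * p / 2 * (‖ψ z‖ ^ 2 - ‖z‖ ^ 2) ≤ K := by
    intro z
    have h1 := (ENNReal.le_div_iff_mul_le (Or.inl hA0) (Or.inr hI.ne)).2 (key z)
    have h2 := (ENNReal.ofReal_le_iff_le_toReal hK).1 h1
    linarith [Real.add_one_le_exp (α * p / 2 * (‖ψ z‖ ^ 2 - ‖z‖ ^ 2))]
  have e3 : 0 < α * p / 2 := by positivity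
  refine ⟨K / (α * p / 2), div_nonneg ENNReal.toReal_nonneg e3.le, fun z => ?_⟩
  have := (le_div_iff₀' e3).2 (hlog z)
  linarith

theorem compOp_necessary {α p : ℝ} (hα : 0 < α) (hp : 0 < p) {ψ : ℂ → ℂ}
    (hψ : Differentiable ℂ ψ) (hT : ∀ f ∈ FockSupSpace α, compOp ψ f ∈ FockSpace α p) :
    ∃ a b : ℂ, ‖a‖ < 1 ∧ ∀ z, ψ z = a * z + b := by
  have hI := lintegral_exp_lt_top_of_compOp_mem hα hp hψ hT
  obtain ⟨C, hC, hle⟩ := exists_norm_sq_le_of_lintegral_exp_lt_top hα hp hψ hI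
  obtain ⟨a, b, hab⟩ := exists_affine_of_norm_le hψ (A := √C) (B := 1) (Real.sqrt_nonneg _)
    zero_le_one fun z => by
      refine le_of_sq_le_sq ?_ (by positivity)
      nlinarith [hle z, Real.sq_sqrt hC, mul_nonneg (Real.sqrt_nonneg C) (norm_nonneg z)]
  refine ⟨a, b, ?_, hab⟩
  by_contra! ha
  -- On this half-plane the cross term of |az + b|² is nonnegative, so |ψ(z)| ≥ |z| when |a| ≥ 1.
  refine hI.ne (lintegral_eq_top_of_le (S := {z : ℂ | 0 ≤ (a * starRingEnd ℂ b * z).re}) ?_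
    (volume_half_plane _) (ε := 1) one_ne_zero fun z hz => ?_)
  · exact (isClosed_le continuous_const (by fun_prop)).measurableSet
  · rw [← ENNReal.ofReal_one]
    refine ENNReal.ofReal_le_ofReal (Real.one_le_exp (mul_nonneg (by positivity) ?_))
    have e : ‖ψ z‖ ^ 2 = ‖a‖ ^ 2 * ‖z‖ ^ 2 + 2 * (a * starRingEnd ℂ b * z).re + ‖b‖ ^ 2 := by
      rw [hab]
      simp only [Complex.sq_norm, Complex.normSq_apply]
      simp [Complex.mul_re, Complex.mul_im]
      ring
    have hz' : 0 ≤ (a * starRingEnd ℂ b * z).re := hz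
    have : 1 * ‖z‖ ^ 2 ≤ ‖a‖ ^ 2 * ‖z‖ ^ 2 := by gcongr; nlinarith
    rw [e]
    nlinarith [sq_nonneg ‖b‖]

/-! ### Necessity for the Volterra operator -/

theorem differentiable_deriv_of_entire {g : ℂ → ℂ} (hg : Differentiable ℂ g) :
    Differentiable ℂ (deriv g) := fun z => (hg.analyticAt z).deriv.differentiableAt

/-- The entire function f g' has a global primitive, and the segment integral is its increment from
0. -/
theorem hasDerivAt_volterraOp {g f : ℂ → ℂ} (hg : Differentiable ℂ g) (hf : Differentiable ℂ f)
    (z : ℂ) : HasDerivAt (volterraOp g f) (f z * deriv g z) z := by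
  have hd := hf.mul (differentiable_deriv_of_entire hg)
  obtain ⟨H, hH⟩ := hd.isExactOn_univ
  have he : volterraOp g f = fun w => H w - H 0 := by
    funext w
    have h1 : ∀ t ∈ Set.uIcc (0 : ℝ) 1, HasDerivAt (fun t : ℝ => H (t * w))
        (f (t * w) * deriv g (t * w) * w) t := fun t _ => by
      have h2 : HasDerivAt (fun t : ℝ => (t : ℂ) * w) w t := by
        simpa using (Complex.ofRealCLM.hasDerivAt (x := t)).mul_const w
      exact (hH (t * w) (Set.mem_univ _)).comp t h2
    have h3 : Continuous fun t : ℝ => f (t * w) * deriv g (t * w) * w := by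
      have h4 : Continuous fun t : ℝ => (t : ℂ) * w := by fun_prop
      exact (hd.continuous.comp h4).mul continuous_const
    have := intervalIntegral.integral_eq_sub_of_hasDerivAt h1 (h3.intervalIntegrable 0 1)
    rw [volterraOp, this]
    simp
  rw [he]
  exact (hH z (Set.mem_univ _)).sub_const _

/-- The density of the `p`-th power of the norm of `F^p_α`. -/
noncomputable def fockDensity (α p : ℝ) (G : ℂ → ℂ) (z : ℂ) : ℝ≥0∞ :=
  ENNReal.ofReal (‖G z‖ ^ p * Real.exp (-(α * p / 2) * ‖z‖ ^ 2))

theorem measurable_fockDensity {α p : ℝ} (hp : 0 < p) {G : ℂ → ℂ} (hG : Continuous G) :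
    Measurable (fockDensity α p G) := by
  have h1 : Continuous fun z => ‖G z‖ ^ p := hG.norm.rpow_const fun _ => Or.inr hp.le
  exact (ENNReal.continuous_ofReal.comp (h1.mul (by fun_prop))).measurable

/-- The translate of `G` by `z` that preserves the weighted modulus. -/
noncomputable def weylTranslate (α : ℝ) (G : ℂ → ℂ) (z ζ : ℂ) : ℂ :=
  G (z + ζ) * Complex.exp (-α * (starRingEnd ℂ z * ζ) - (α / 2 * ‖z‖ ^ 2 : ℝ))

theorem norm_weylTranslate (α : ℝ) (G : ℂ → ℂ) (z ζ : ℂ) :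
    ‖weylTranslate α G z ζ‖ =
      ‖G (z + ζ)‖ * Real.exp (-(α / 2) * ‖z + ζ‖ ^ 2) * Real.exp (α / 2 * ‖ζ‖ ^ 2) := by
  rw [weylTranslate, norm_mul, Complex.norm_exp, mul_assoc, ← Real.exp_add]
  congr 2
  have e2 : ‖z + ζ‖ ^ 2 = ‖z‖ ^ 2 + 2 * (starRingEnd ℂ z * ζ).re + ‖ζ‖ ^ 2 := by
    simp only [Complex.sq_norm, Complex.normSq_apply]
    simp [Complex.mul_re]
    ring
  rw [e2, Complex.sub_re, Complex.ofReal_re, ← Complex.ofReal_neg, Complex.re_ofReal_mul]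
  ring

theorem differentiable_weylTranslate (α : ℝ) {G : ℂ → ℂ} (hG : Differentiable ℂ G) (z : ℂ) :
    Differentiable ℂ (weylTranslate α G z) := by
  have : Differentiable ℂ fun ζ => G (z + ζ) := hG.comp (by fun_prop)
  unfold weylTranslate
  fun_prop

theorem deriv_weylTranslate_zero (α : ℝ) {G : ℂ → ℂ} (hG : Differentiable ℂ G) (z : ℂ) :
    deriv (weylTranslate α G z) 0 = deriv G z * Complex.exp (-(α / 2 * ‖z‖ ^ 2 : ℝ)) +
      weylTranslate α G z 0 * (-α * starRingEnd ℂ z) := by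
  have h1 : HasDerivAt (fun ζ => G (z + ζ)) (deriv G z) 0 := by
    have h : HasDerivAt G (deriv G z) (z + 0) := by
      rw [add_zero]; exact (hG z).hasDerivAt
    exact h.comp_const_add z 0
  have h2 : HasDerivAt (fun ζ : ℂ => -α * (starRingEnd ℂ z * ζ) - (α / 2 * ‖z‖ ^ 2 : ℝ))
      (-α * starRingEnd ℂ z) 0 := by
    have := (((hasDerivAt_id (0 : ℂ)).const_mul (starRingEnd ℂ z)).const_mul (-α : ℂ)).sub_const
      ((α / 2 * ‖z‖ ^ 2 : ℝ) : ℂ)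
    simpa using this
  have h3 : HasDerivAt (weylTranslate α G z) _ 0 := h1.mul h2.cexp
  rw [h3.deriv]
  simp only [weylTranslate, add_zero, mul_zero, zero_sub]
  ring

/-- The integral of `fockDensity α p G` over the disc of radius `2` around `z`. -/
noncomputable def localMass (α p : ℝ) (G : ℂ → ℂ) (z : ℂ) : ℝ≥0∞ :=
  ∫⁻ ζ, (Metric.closedBall (0 : ℂ) 2).indicator 1 ζ * fockDensity α p G (z + ζ)

theorem localMass_le (α p : ℝ) (G : ℂ → ℂ) (z : ℂ) :
    localMass α p G z ≤ ∫⁻ ζ, fockDensity α p G ζ := by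
  rw [← lintegral_add_left_eq_self (fockDensity α p G) z]
  refine lintegral_mono fun ζ => mul_le_of_le_one_left' ?_
  exact Set.indicator_le_self' (fun _ _ => zero_le) ζ

theorem measurable_localMass_integrand {α p : ℝ} (hp : 0 < p) {G : ℂ → ℂ} (hG : Continuous G) :
    Measurable (Function.uncurry fun z ζ =>
      (Metric.closedBall (0 : ℂ) 2).indicator 1 ζ * fockDensity α p G (z + ζ)) := by
  have h1 : Measurable ((Metric.closedBall (0 : ℂ) 2).indicator (1 : ℂ → ℝ≥0∞)) :=
    measurable_one.indicator measurableSet_closedBall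
  exact (h1.comp measurable_snd).mul
    ((measurable_fockDensity hp hG).comp (measurable_fst.add measurable_snd))

theorem measurable_localMass {α p : ℝ} (hp : 0 < p) {G : ℂ → ℂ} (hG : Continuous G) :
    Measurable (localMass α p G) :=
  (measurable_localMass_integrand hp hG).lintegral_prod_right'

/-- Tonelli and translation invariance. With `localMass_le`, local masses are thus both bounded and
integrable when the norm is finite. -/
theorem lintegral_localMass {α p : ℝ} (hp : 0 < p) {G : ℂ → ℂ} (hG : Continuous G) :
    ∫⁻ z, localMass α p G z =
      volume (Metric.closedBall (0 : ℂ) 2) * ∫⁻ ζ, fockDensity α p G ζ := by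
  unfold localMass
  rw [lintegral_lintegral_swap (measurable_localMass_integrand hp hG).aemeasurable]
  have h : ∀ ζ : ℂ, ∫⁻ z, (Metric.closedBall (0 : ℂ) 2).indicator 1 ζ * fockDensity α p G (z + ζ) =
      (Metric.closedBall (0 : ℂ) 2).indicator 1 ζ * ∫⁻ z, fockDensity α p G z := fun ζ => by
    rw [lintegral_const_mul, lintegral_add_right_eq_self (fockDensity α p G) ζ]
    exact (measurable_fockDensity hp hG).comp (measurable_id.add_const ζ)
  simp_rw [h]
  rw [lintegral_mul_const _ (measurable_one.indicator measurableSet_closedBall),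
    lintegral_indicator_one measurableSet_closedBall]

/-- The mean value inequality on the unit disc about ζ, which lies in the disc of radius 2 about 0.
There the factor exp(αp|·|²/2) is at most exp(2αp). -/
theorem norm_weylTranslate_rpow_le {α p : ℝ} (hα : 0 < α) (hp : 0 < p) {G : ℂ → ℂ}
    (hG : Differentiable ℂ G) (z : ℂ) {ζ : ℂ} (hζ : ‖ζ‖ ≤ 1) :
    ENNReal.ofReal (‖weylTranslate α G z ζ‖ ^ p) * volume (Metric.closedBall (0 : ℂ) 1) ≤
      ENNReal.ofReal (Real.exp (2 * α * p)) * localMass α p G z := by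
  set φ : ℝ → ℝ≥0∞ := (Set.Iic 1).indicator 1 with hφ
  have hφm : Measurable φ := measurable_one.indicator measurableSet_Iic
  have hφb : ∀ w : ℂ, φ ‖w‖ = (Metric.closedBall (0 : ℂ) 1).indicator 1 w := fun w => by
    by_cases hw : ‖w‖ ≤ 1 <;> simp [hφ, Set.indicator, hw]
  have h := ofReal_norm_rpow_mul_lintegral_le (differentiable_weylTranslate α hG z) hp ζ hφm
  simp_rw [hφb] at h
  rw [lintegral_indicator_one measurableSet_closedBall] at h
  refine h.trans ?_
  rw [localMass, ← lintegral_const_mul' _ _ ENNReal.ofReal_ne_top]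
  rw [← lintegral_add_left_eq_self (fun ξ => ENNReal.ofReal (Real.exp (2 * α * p)) *
    ((Metric.closedBall (0 : ℂ) 2).indicator 1 ξ * fockDensity α p G (z + ξ))) ζ]
  refine lintegral_mono fun w => ?_
  by_cases hw : ‖w‖ ≤ 1
  · have hw2 : ‖ζ + w‖ ≤ 2 := (norm_add_le _ _).trans (by linarith)
    rw [Set.indicator_of_mem (by simpa using hw), Set.indicator_of_mem (by simpa using hw2)]
    simp only [Pi.one_apply, mul_one, one_mul]
    rw [fockDensity, ← ENNReal.ofReal_mul (Real.exp_pos _).le, norm_weylTranslate]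
    refine ENNReal.ofReal_le_ofReal ?_
    rw [Real.mul_rpow (by positivity) (by positivity), Real.mul_rpow (by positivity) (by positivity),
      ← Real.exp_mul, ← Real.exp_mul, mul_comm (Real.exp (2 * α * p))]
    rw [show -(α / 2) * ‖z + (ζ + w)‖ ^ 2 * p = -(α * p / 2) * ‖z + (ζ + w)‖ ^ 2 by ring]
    refine mul_le_mul_of_nonneg_left (Real.exp_le_exp.2 ?_) (by positivity)
    have : ‖ζ + w‖ ^ 2 ≤ 2 ^ 2 := by gcongr
    have := mul_le_mul_of_nonneg_left this (by positivity : 0 ≤ α * p / 2)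
    linarith
  · rw [Set.indicator_of_notMem (by simpa using hw)]
    simp

/-- The derivative of an entire function is controlled by its local mass. -/
theorem norm_deriv_rpow_le_localMass {α p : ℝ} (hα : 0 < α) (hp : 0 < p) :
    ∃ C : ℝ≥0∞, C ≠ ∞ ∧ ∀ (G : ℂ → ℂ), Differentiable ℂ G → ∀ z,
      ENNReal.ofReal ((‖deriv G z‖ * Real.exp (-(α / 2) * ‖z‖ ^ 2) / (1 + α * ‖z‖)) ^ p) ≤
        C * localMass α p G z := by
  set V := volume (Metric.closedBall (0 : ℂ) 1)
  have hV0 : V ≠ 0 := (Metric.measure_closedBall_pos volume _ one_pos).ne'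
  have hV1 : V ≠ ∞ := measure_closedBall_lt_top.ne
  refine ⟨ENNReal.ofReal (Real.exp (2 * α * p)) / V,
    (ENNReal.div_lt_top ENNReal.ofReal_ne_top hV0).ne, fun G hG z => ?_⟩
  set J := ENNReal.ofReal (Real.exp (2 * α * p)) / V * localMass α p G z with hJ
  by_cases hJt : J = ∞
  · rw [hJt]; exact le_top
  have hK : ∀ ζ : ℂ, ‖ζ‖ ≤ 1 → ‖weylTranslate α G z ζ‖ ≤ J.toReal ^ (1 / p) := by
    intro ζ hζ
    have h1 : ENNReal.ofReal (‖weylTranslate α G z ζ‖ ^ p) ≤ J := by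
      rw [hJ, ENNReal.div_eq_inv_mul, mul_assoc, ← ENNReal.div_eq_inv_mul]
      exact (ENNReal.le_div_iff_mul_le (Or.inl hV0) (Or.inl hV1)).2
        (norm_weylTranslate_rpow_le hα hp hG z hζ)
    have h2 := (ENNReal.ofReal_le_iff_le_toReal hJt).1 h1
    have h3 := Real.rpow_le_rpow (by positivity) h2 (by positivity : 0 ≤ 1 / p)
    rwa [← Real.rpow_mul (norm_nonneg _), mul_one_div_cancel hp.ne', Real.rpow_one] at h3
  set b := J.toReal ^ (1 / p) with hb
  have hb0 : 0 ≤ b := by positivity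
  have hd := Complex.norm_deriv_le_of_forall_mem_sphere_norm_le (c := 0) one_pos
    (differentiable_weylTranslate α hG z).diffContOnCl fun w hw =>
      hK w (by simpa using (mem_sphere_zero_iff_norm.1 hw).le)
  rw [div_one] at hd
  have h0 := hK 0 (by simp)
  have hpos : 0 < 1 + α * ‖z‖ := by positivity
  have hmain : ‖deriv G z‖ * Real.exp (-(α / 2) * ‖z‖ ^ 2) ≤ b * (1 + α * ‖z‖) := by
    -- Differentiating the exponential in the translate produces the second term; its factor α|z| is
    -- the source of the divisor 1 + α|z|.
    have e : deriv G z * Complex.exp (-(α / 2 * ‖z‖ ^ 2 : ℝ)) =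
        deriv (weylTranslate α G z) 0 + weylTranslate α G z 0 * (α * starRingEnd ℂ z) := by
      rw [deriv_weylTranslate_zero α hG]
      ring
    have e' := congrArg norm e
    rw [norm_mul, Complex.norm_exp, ← Complex.ofReal_neg, Complex.ofReal_re, ← neg_mul] at e'
    rw [e']
    refine (norm_add_le _ _).trans ?_
    rw [norm_mul, norm_mul, Complex.norm_real, Real.norm_of_nonneg hα.le, RCLike.norm_conj]
    have := mul_le_mul_of_nonneg_right h0 (by positivity : 0 ≤ α * ‖z‖)
    linarith
  have h5 := Real.rpow_le_rpow (by positivity) ((div_le_iff₀ hpos).2 hmain) hp.le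
  rw [hb, ← Real.rpow_mul ENNReal.toReal_nonneg, one_div_mul_cancel hp.ne', Real.rpow_one] at h5
  exact (ENNReal.ofReal_le_iff_le_toReal hJt).2 h5

/-- At each z some theta translate attains the full growth, and the derivative of its image is that
translate times g', so the weight cancels and |g'| remains. The majorant is a multiple of the sum of
the local masses of the images. -/
theorem exists_deriv_bounds_of_volterraOp_mem {α p : ℝ} (hα : 0 < α) (hp : 0 < p) {g : ℂ → ℂ}
    (hg : Differentiable ℂ g) (hT : ∀ f ∈ FockSupSpace α, volterraOp g f ∈ FockSpace α p) :
    ∃ Φ : ℂ → ℝ≥0∞, (∃ M : ℝ≥0∞, M ≠ ∞ ∧ ∀ z, Φ z ≤ M) ∧ ∫⁻ z, Φ z < ∞ ∧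
      ∀ z, ENNReal.ofReal ((‖deriv g z‖ / (1 + α * ‖z‖)) ^ p) ≤ Φ z := by
  obtain ⟨t, c, hc, h⟩ := exists_finset_extremal_rpow hα hp
  obtain ⟨C, hC, hCle⟩ := norm_deriv_rpow_le_localMass hα hp
  set G : ℂ → ℂ → ℂ := fun a => volterraOp g (fockTheta α a) with hGdef
  have hGd : ∀ a z, HasDerivAt (G a) (fockTheta α a z * deriv g z) z := fun a z =>
    hasDerivAt_volterraOp hg (differentiable_fockTheta α a) z
  have hG : ∀ a, Differentiable ℂ (G a) := fun a z => (hGd a z).differentiableAt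
  have hfin : ∀ a ∈ t, ∫⁻ z, fockDensity α p (G a) z < ∞ := fun a _ =>
    (fockNorm_lt_top_iff hα hp).1 (hT _ (fockTheta_mem hα a)).2
  have hc0 : ENNReal.ofReal c ≠ 0 := by simpa using hc
  have hκ : C / ENNReal.ofReal c ≠ ∞ := (ENNReal.div_lt_top hC hc0).ne
  refine ⟨fun z => C / ENNReal.ofReal c * ∑ a ∈ t, localMass α p (G a) z,
    ⟨C / ENNReal.ofReal c * ∑ a ∈ t, ∫⁻ z, fockDensity α p (G a) z, ?_, fun z => ?_⟩, ?_,
    fun z => ?_⟩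
  · exact ENNReal.mul_ne_top hκ (ENNReal.sum_lt_top.2 hfin).ne
  · exact mul_le_mul_right (Finset.sum_le_sum fun a _ => localMass_le α p (G a) z) _
  · rw [lintegral_const_mul' _ _ hκ, lintegral_finsetSum _ fun a _ =>
      measurable_localMass hp (hG a).continuous]
    refine ENNReal.mul_lt_top hκ.lt_top (ENNReal.sum_lt_top.2 fun a ha => ?_)
    rw [lintegral_localMass hp (hG a).continuous]
    exact ENNReal.mul_lt_top measure_closedBall_lt_top (hfin a ha)
  · obtain ⟨a, ha, h'⟩ := h z
    have h1 := (hCle (G a) (hG a) z).trans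
      (mul_le_mul_right (Finset.single_le_sum (f := fun a => localMass α p (G a) z)
        (fun _ _ => zero_le) ha) C)
    simp only
    rw [ENNReal.div_eq_inv_mul, mul_assoc, ← ENNReal.div_eq_inv_mul]
    refine (ENNReal.le_div_iff_mul_le (Or.inl hc0) (Or.inl ENNReal.ofReal_ne_top)).2
      (le_trans ?_ h1)
    rw [← ENNReal.ofReal_mul (by positivity)]
    refine ENNReal.ofReal_le_ofReal ?_
    have hpos : 0 < 1 + α * ‖z‖ := by positivity
    rw [(hGd a z).deriv, norm_mul,
      show ‖fockTheta α a z‖ * ‖deriv g z‖ * Real.exp (-(α / 2) * ‖z‖ ^ 2) / (1 + α * ‖z‖) =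
        ‖deriv g z‖ / (1 + α * ‖z‖) * (‖fockTheta α a z‖ * Real.exp (-(α / 2) * ‖z‖ ^ 2)) by ring,
      Real.mul_rpow (by positivity) (by positivity)]
    gcongr
    rw [Real.mul_rpow (by positivity) (by positivity), ← Real.exp_mul]
    calc c = c * Real.exp (α * p / 2 * ‖z‖ ^ 2) * Real.exp (-(α / 2) * ‖z‖ ^ 2 * p) := by
          rw [mul_assoc, ← Real.exp_add,
            show α * p / 2 * ‖z‖ ^ 2 + -(α / 2) * ‖z‖ ^ 2 * p = 0 by ring, Real.exp_zero, mul_one]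
      _ ≤ _ := by gcongr

/-- In polar coordinates, for r > 1, the integrand dominates a multiple of r · r⁻² = r⁻¹. -/
theorem lintegral_one_add_rpow_neg_eq_top {α p : ℝ} (hα : 0 < α) (hp : p ≤ 2) :
    ∫⁻ z : ℂ, ENNReal.ofReal ((1 + α * ‖z‖) ^ (-p)) = ∞ := by
  have hm : Measurable fun r : ℝ => ENNReal.ofReal ((1 + α * r) ^ (-p)) := by fun_prop
  rw [lintegral_norm_eq hm]
  by_contra hne
  set k : ℝ := 2 * Real.pi * (1 + α) ^ (-2 : ℝ) with hk
  have hk0 : 0 < k := by positivity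
  have hle : ENNReal.ofReal k * ∫⁻ r in Set.Ioi (1 : ℝ), ENNReal.ofReal r⁻¹ ≤
      ∫⁻ r in Set.Ioi (0 : ℝ), ENNReal.ofReal r *
        (ENNReal.ofReal (2 * Real.pi) * ENNReal.ofReal ((1 + α * r) ^ (-p))) := by
    rw [← lintegral_const_mul' _ _ ENNReal.ofReal_ne_top]
    refine (setLIntegral_mono' measurableSet_Ioi fun r hr => ?_).trans
      (lintegral_mono_set (Set.Ioi_subset_Ioi zero_le_one))
    have hr1 : 1 < r := hr
    have hr0 : 0 < r := one_pos.trans hr1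
    rw [← ENNReal.ofReal_mul (by positivity), ← ENNReal.ofReal_mul (by positivity),
      ← ENNReal.ofReal_mul (by positivity)]
    refine ENNReal.ofReal_le_ofReal ?_
    have h1 : ((1 + α) * r) ^ (-2 : ℝ) ≤ (1 + α * r) ^ (-p) := by
      calc ((1 + α) * r) ^ (-2 : ℝ) ≤ (1 + α * r) ^ (-2 : ℝ) :=
            Real.rpow_le_rpow_of_nonpos (by positivity) (by nlinarith) (by norm_num)
        _ ≤ (1 + α * r) ^ (-p) :=
            Real.rpow_le_rpow_of_exponent_le (by nlinarith [mul_pos hα hr0]) (by linarith)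
    rw [Real.mul_rpow (by positivity) hr0.le, Real.rpow_neg hr0.le, Real.rpow_two] at h1
    calc k * r⁻¹ = r * (2 * Real.pi * ((1 + α) ^ (-2 : ℝ) * (r ^ 2)⁻¹)) := by
          rw [hk]; field_simp
      _ ≤ _ := by gcongr
  have hfin : ∫⁻ r in Set.Ioi (1 : ℝ), ENNReal.ofReal r⁻¹ < ∞ :=
    ENNReal.lt_top_of_mul_ne_top_right (hle.trans_lt (lt_top_iff_ne_top.2 hne)).ne
      (by simpa using hk0)
  refine not_integrableOn_Ioi_inv (a := (1 : ℝ)) ⟨measurable_inv.aestronglyMeasurable, ?_⟩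
  rw [hasFiniteIntegral_iff_ofReal]
  · exact hfin
  · exact (ae_restrict_mem measurableSet_Ioi).mono fun r hr =>
      inv_nonneg.2 (zero_le_one.trans (le_of_lt hr))

theorem volterraOp_necessary {α p : ℝ} (hα : 0 < α) (hp : 0 < p) {g : ℂ → ℂ}
    (hg : Differentiable ℂ g) (hT : ∀ f ∈ FockSupSpace α, volterraOp g f ∈ FockSpace α p) :
    (∃ b : ℂ, ∀ z, g z = b) ∨ ((∃ a b : ℂ, ∀ z, g z = a * z + b) ∧ 2 < p) := by
  obtain ⟨Φ, ⟨M, hM, hΦM⟩, hΦint, hΦ⟩ := exists_deriv_bounds_of_volterraOp_mem hα hp hg hT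
  have hb : ∀ z, ‖deriv g z‖ ≤ M.toReal ^ (1 / p) + M.toReal ^ (1 / p) * α * ‖z‖ := fun z => by
    have hpos : 0 < 1 + α * ‖z‖ := by positivity
    have h1 := (ENNReal.ofReal_le_iff_le_toReal hM).1 ((hΦ z).trans (hΦM z))
    have h3 := Real.rpow_le_rpow (by positivity) h1 (by positivity : 0 ≤ 1 / p)
    rw [← Real.rpow_mul (by positivity), mul_one_div_cancel hp.ne', Real.rpow_one,
      div_le_iff₀ hpos] at h3
    linarith
  obtain ⟨a, b, hab⟩ := exists_affine_of_norm_le (differentiable_deriv_of_entire hg)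
    (by positivity) (by positivity) hb
  have hlt := (lintegral_mono hΦ).trans_lt hΦint
  have ha : a = 0 := by
    by_contra ha
    have ha' : 0 < ‖a‖ := norm_pos_iff.2 ha
    -- Beyond this radius |b| ≤ |a||z|/2, hence |g'(z)| ≥ |a||z|/2, while 1 + α|z| ≤ (1 + α)|z|.
    refine hlt.ne (lintegral_eq_top_of_le (S := (Metric.ball (0 : ℂ) (1 + 2 * ‖b‖ / ‖a‖))ᶜ)
      measurableSet_ball.compl (volume_compl_ball _)
      (ε := ENNReal.ofReal ((‖a‖ / (2 * (1 + α))) ^ p)) (by simp; positivity) fun z hz => ?_)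
    have hz' : 1 + 2 * ‖b‖ / ‖a‖ ≤ ‖z‖ := by simpa using hz
    have hz1 : 1 ≤ ‖z‖ := le_trans (le_add_of_nonneg_right (by positivity)) hz'
    have hz2 : 2 * ‖b‖ ≤ ‖a‖ * ‖z‖ := by
      rw [← div_le_iff₀' ha']
      linarith
    refine ENNReal.ofReal_le_ofReal (Real.rpow_le_rpow (by positivity) ?_ hp.le)
    have h1 : ‖a‖ * ‖z‖ ≤ ‖deriv g z‖ + ‖b‖ := by
      rw [← norm_mul, hab]
      simpa using norm_sub_le (a * z + b) b
    rw [div_le_div_iff₀ (by positivity) (by positivity)]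
    have h2 : 1 + α * ‖z‖ ≤ (1 + α) * ‖z‖ := by linarith
    have h3 : ‖a‖ * ‖z‖ ≤ 2 * ‖deriv g z‖ := by linarith
    calc ‖a‖ * (1 + α * ‖z‖) ≤ ‖a‖ * ((1 + α) * ‖z‖) := by gcongr
      _ = (1 + α) * (‖a‖ * ‖z‖) := by ring
      _ ≤ (1 + α) * (2 * ‖deriv g z‖) := by gcongr
      _ = _ := by ring
  have hg' : ∀ z, g z = b * z + g 0 := fun z => by
    have hk : Differentiable ℂ fun z => g z - b * z := by fun_prop
    have := is_const_of_deriv_eq_zero hk (fun w => by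
      have h1 : HasDerivAt (fun z => g z - b * z) (deriv g w - b * 1) w :=
        (hg w).hasDerivAt.sub ((hasDerivAt_id w).const_mul _)
      rw [h1.deriv, hab, ha]
      ring) z 0
    simp only [mul_zero, sub_zero] at this
    rw [← this]
    ring
  by_cases hb0 : b = 0
  · exact Or.inl ⟨g 0, fun z => by rw [hg' z, hb0, zero_mul, zero_add]⟩
  · refine Or.inr ⟨⟨b, g 0, hg'⟩, ?_⟩
    by_contra! hp2
    have hbn : 0 < ‖b‖ := norm_pos_iff.2 hb0
    have h1 : ∀ z : ℂ, ENNReal.ofReal ((‖deriv g z‖ / (1 + α * ‖z‖)) ^ p) =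
        ENNReal.ofReal (‖b‖ ^ p) * ENNReal.ofReal ((1 + α * ‖z‖) ^ (-p)) := fun z => by
      have hpos : 0 < 1 + α * ‖z‖ := by positivity
      rw [hab, ha, zero_mul, zero_add, Real.div_rpow (norm_nonneg _) hpos.le,
        ← ENNReal.ofReal_mul (by positivity), Real.rpow_neg hpos.le, div_eq_mul_inv]
    simp_rw [h1] at hlt
    rw [lintegral_const_mul' _ _ ENNReal.ofReal_ne_top, lintegral_one_add_rpow_neg_eq_top hα hp2,
      ENNReal.mul_top (by simp; positivity)] at hlt
    exact lt_irrefl _ hlt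

/-! ### Normal families and dominated convergence -/

theorem norm_le_of_fockSupNorm_le {α : ℝ} {f : ℂ → ℂ} {S : ℝ} (hS : 0 ≤ S)
    (h : fockSupNorm α f ≤ ENNReal.ofReal S) (z : ℂ) :
    ‖f z‖ ≤ S * Real.exp (α / 2 * ‖z‖ ^ 2) := by
  have h1 := (le_iSup (fun z : ℂ =>
    ENNReal.ofReal (‖f z‖ * Real.exp (-(α / 2) * ‖z‖ ^ 2))) z).trans h
  have h2 := (ENNReal.ofReal_le_ofReal_iff hS).1 h1
  calc ‖f z‖ = ‖f z‖ * Real.exp (-(α / 2) * ‖z‖ ^ 2) * Real.exp (α / 2 * ‖z‖ ^ 2) := by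
        rw [mul_assoc, ← Real.exp_add, neg_mul, neg_add_cancel, Real.exp_zero, mul_one]
    _ ≤ _ := by gcongr

/-- A sequence of entire functions that is bounded on every disc has a subsequence that converges
pointwise to an entire function. -/
theorem exists_subseq_tendsto_of_norm_le {f : ℕ → ℂ → ℂ} (hf : ∀ n, Differentiable ℂ (f n))
    {B : ℝ → ℝ} (hB : ∀ n z, ‖f n z‖ ≤ B ‖z‖) :
    ∃ g : ℂ → ℂ, Differentiable ℂ g ∧ ∃ φ : ℕ → ℕ, StrictMono φ ∧
      ∀ z, Tendsto (fun n => f (φ n) z) atTop (𝓝 (g z)) := by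
  set a : ℕ → ℕ → ℂ := fun n k => (k.factorial : ℂ)⁻¹ * iteratedDeriv k (f n) 0 with ha
  have hbound : ∀ R : ℝ, 0 < R → ∀ n k, ‖a n k‖ ≤ B R / R ^ k := by
    intro R hR n k
    have h := Complex.norm_iteratedDeriv_le_of_forall_mem_sphere_norm_le (c := 0) (C := B R) k hR
      (hf n).diffContOnCl fun z hz => by
        have : ‖z‖ = R := by simpa using hz
        rw [← this]
        exact hB n z
    rw [ha]
    simp only [norm_mul, norm_inv, Complex.norm_natCast]
    rw [inv_mul_le_iff₀ (by positivity), ← mul_div_assoc]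
    exact h
  -- Tychonoff replaces the diagonal argument: the Taylor coefficient sequences lie in a product of
  -- closed discs, and a subsequence converges coefficientwise.
  obtain ⟨b, -, φ, hφ, hlim⟩ := (isCompact_univ_pi
    (fun k : ℕ => isCompact_closedBall (0 : ℂ) (B 1))).tendsto_subseq (x := a) fun n k _ => by
      simpa using hbound 1 one_pos n k
  have hlim' : ∀ k, Tendsto (fun n => a (φ n) k) atTop (𝓝 (b k)) :=
    fun k => (tendsto_pi_nhds.1 hlim) k
  have hb : ∀ R : ℝ, 0 < R → ∀ k, ‖b k‖ ≤ B R / R ^ k := fun R hR k =>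
    le_of_tendsto (hlim' k).norm (Eventually.of_forall fun n => hbound R hR (φ n) k)
  -- Cauchy bounds at radius 2R give a geometric majorant on |z| ≤ R, uniform in n.
  have hterm : ∀ R : ℝ, 0 < R → ∀ (x z : ℂ) (k : ℕ), ‖x‖ ≤ B (2 * R) / (2 * R) ^ k → ‖z‖ ≤ R →
      ‖x * z ^ k‖ ≤ B (2 * R) * (1 / 2) ^ k := by
    intro R hR x z k hx hz
    rw [norm_mul, norm_pow]
    calc ‖x‖ * ‖z‖ ^ k ≤ B (2 * R) / (2 * R) ^ k * R ^ k := by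
          gcongr
          exact (norm_nonneg _).trans hx
      _ = B (2 * R) * (1 / 2) ^ k := by
          rw [mul_pow, one_div, inv_pow]
          field_simp
  have hsum : ∀ R : ℝ, Summable fun k : ℕ => B (2 * R) * (1 / 2 : ℝ) ^ k := fun R =>
    summable_geometric_two.mul_left _
  refine ⟨fun z => ∑' k, b k * z ^ k, fun z => ?_, φ, hφ, fun z => ?_⟩
  · have hR : 0 < ‖z‖ + 1 := by positivity
    refine (Complex.differentiableOn_tsum_of_summable_norm (U := Metric.ball 0 (‖z‖ + 1))
      (hsum (‖z‖ + 1)) (fun k => by fun_prop) Metric.isOpen_ball fun k w hw =>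
        hterm _ hR _ _ _ (hb _ (by positivity) k) ?_).differentiableAt
        (Metric.isOpen_ball.mem_nhds (by simp))
    exact (mem_ball_zero_iff.1 hw).le
  · have hR : 0 < ‖z‖ + 1 := by positivity
    have hf' : ∀ n, f (φ n) z = ∑' k, a (φ n) k * z ^ k := fun n => by
      rw [← (Complex.hasSum_taylorSeries_of_entire (hf (φ n)) 0 z).tsum_eq]
      refine tsum_congr fun k => ?_
      simp only [ha, sub_zero, smul_eq_mul]
      ring
    simp_rw [hf']
    exact tendsto_tsum_of_dominated_convergence (hsum (‖z‖ + 1))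
      (fun k => (hlim' k).mul_const _) (Eventually.of_forall fun n k =>
        hterm _ hR _ _ _ (hbound _ (by positivity) (φ n) k) (by linarith))

theorem fockNorm_le_of_norm_le {α p : ℝ} (hp : 0 < p) {F : ℂ → ℂ} {D : ℂ → ℝ} (hD : ∀ z, 0 ≤ D z)
    {S : ℝ} (hS : 0 ≤ S) (h : ∀ z, ‖F z‖ ≤ S * D z) :
    fockNorm α p F ≤ ENNReal.ofReal S * fockNorm α p fun z => (D z : ℂ) := by
  have hS' : ENNReal.ofReal S = ENNReal.ofReal (S ^ p) ^ (1 / p) := by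
    rw [ENNReal.ofReal_rpow_of_nonneg (by positivity) (by positivity), ← Real.rpow_mul hS,
      mul_one_div_cancel hp.ne', Real.rpow_one]
  rw [fockNorm, fockNorm, hS', ← ENNReal.mul_rpow_of_nonneg _ _ (by positivity)]
  refine ENNReal.rpow_le_rpow ?_ (by positivity)
  rw [mul_left_comm, ← lintegral_const_mul' (ENNReal.ofReal (S ^ p)) _ ENNReal.ofReal_ne_top]
  refine mul_le_mul_right (lintegral_mono fun z => ?_) _
  rw [← ENNReal.ofReal_mul (by positivity), Complex.norm_real, Real.norm_of_nonneg (hD z),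
    ← mul_assoc, ← Real.mul_rpow hS (hD z)]
  gcongr
  exact h z

/-- Dominated convergence with majorant (2D)^p; the triangle inequality is used only pointwise, so p
< 1 needs no separate treatment. -/
theorem tendsto_fockNorm_sub {α p : ℝ} (hp : 0 < p) {F : ℕ → ℂ → ℂ} {G : ℂ → ℂ} {D : ℂ → ℝ}
    (hF : ∀ n, Continuous (F n)) (hG : Continuous G) (hFD : ∀ n z, ‖F n z‖ ≤ D z)
    (hD : ∫⁻ z : ℂ, ENNReal.ofReal (D z ^ p * Real.exp (-(α * p / 2) * ‖z‖ ^ 2)) < ∞)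
    (hlim : ∀ z, Tendsto (fun n => F n z) atTop (𝓝 (G z))) :
    Tendsto (fun n => fockNorm α p (F n - G)) atTop (𝓝 0) := by
  have hGD : ∀ z, ‖G z‖ ≤ D z := fun z =>
    le_of_tendsto (hlim z).norm (Eventually.of_forall fun n => hFD n z)
  have hL : Tendsto (fun n => ∫⁻ z : ℂ, ENNReal.ofReal
      (‖(F n - G) z‖ ^ p * Real.exp (-(α * p / 2) * ‖z‖ ^ 2))) atTop (𝓝 (∫⁻ _ : ℂ, 0)) := by
    refine tendsto_lintegral_of_dominated_convergence (fun z => ENNReal.ofReal (2 ^ p) *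
      ENNReal.ofReal (D z ^ p * Real.exp (-(α * p / 2) * ‖z‖ ^ 2))) (fun n => ?_) (fun n => ?_) ?_
      (Eventually.of_forall fun z => ?_)
    · have h1 : Continuous fun z => ‖(F n - G) z‖ ^ p :=
        ((hF n).sub hG).norm.rpow_const fun _ => Or.inr hp.le
      exact (ENNReal.continuous_ofReal.comp (h1.mul (by fun_prop))).measurable
    · refine Eventually.of_forall fun z => ?_
      have hDz : 0 ≤ D z := (norm_nonneg _).trans (hGD z)
      simp only
      rw [← ENNReal.ofReal_mul (by positivity), ← mul_assoc, ← Real.mul_rpow zero_le_two hDz]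
      refine ENNReal.ofReal_le_ofReal ?_
      gcongr
      rw [Pi.sub_apply]
      linarith [norm_sub_le (F n z) (G z), hFD n z, hGD z]
    · rw [lintegral_const_mul' _ _ ENNReal.ofReal_ne_top]
      exact ENNReal.mul_ne_top ENNReal.ofReal_ne_top hD.ne
    · have h1 : Tendsto (fun n => ‖(F n - G) z‖) atTop (𝓝 0) := by
        simpa using ((hlim z).sub_const (G z)).norm
      have h2 := h1.rpow_const (p := p) (Or.inr hp.le)
      rw [Real.zero_rpow hp.ne'] at h2
      have h3 := ENNReal.tendsto_ofReal (h2.mul_const (Real.exp (-(α * p / 2) * ‖z‖ ^ 2)))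
      simpa using h3
  rw [lintegral_zero] at hL
  have h4 := ENNReal.Tendsto.const_mul (a := ENNReal.ofReal (α * p / (2 * Real.pi))) hL
    (Or.inr ENNReal.ofReal_ne_top)
  have h5 := (ENNReal.continuous_rpow_const (y := 1 / p)).tendsto _ |>.comp h4
  rw [mul_zero, ENNReal.zero_rpow_of_pos (by positivity)] at h5
  exact h5

/-- An operator that is dominated pointwise by a function of finite norm and respects dominated
pointwise convergence is bounded and compact. -/
theorem isBoundedFock_and_isCompactFock {α p : ℝ} (hp : 0 < p)
    {T : (ℂ → ℂ) → ℂ → ℂ} {D : ℂ → ℝ} (hD : ∀ z, 0 ≤ D z)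
    (hDint : ∫⁻ z : ℂ, ENNReal.ofReal (D z ^ p * Real.exp (-(α * p / 2) * ‖z‖ ^ 2)) < ∞)
    (hTd : ∀ f, Differentiable ℂ f → Differentiable ℂ (T f))
    (hTb : ∀ f, Differentiable ℂ f → ∀ S : ℝ, 0 ≤ S →
      (∀ z, ‖f z‖ ≤ S * Real.exp (α / 2 * ‖z‖ ^ 2)) → ∀ z, ‖T f z‖ ≤ S * D z)
    (hTc : ∀ (f : ℕ → ℂ → ℂ) (g : ℂ → ℂ) (S : ℝ), 0 ≤ S → (∀ n, Differentiable ℂ (f n)) →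
      (∀ n z, ‖f n z‖ ≤ S * Real.exp (α / 2 * ‖z‖ ^ 2)) →
      (∀ z, Tendsto (fun n => f n z) atTop (𝓝 (g z))) →
      ∀ z, Tendsto (fun n => T (f n) z) atTop (𝓝 (T g z))) :
    IsBoundedFock α p T ∧ IsCompactFock α p T := by
  have hND : fockNorm α p (fun z => (D z : ℂ)) < ∞ := by
    rw [fockNorm, ENNReal.rpow_lt_top_iff_of_pos (by positivity)]
    refine ENNReal.mul_lt_top ENNReal.ofReal_lt_top ?_
    simpa only [Complex.norm_real, Real.norm_of_nonneg (hD _)] using hDint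
  have hle : ∀ f, Differentiable ℂ f → ∀ S : ℝ, 0 ≤ S →
      (∀ z, ‖f z‖ ≤ S * Real.exp (α / 2 * ‖z‖ ^ 2)) →
      fockNorm α p (T f) ≤ ENNReal.ofReal S * fockNorm α p fun z => (D z : ℂ) :=
    fun f hf S hS h => fockNorm_le_of_norm_le hp hD hS (hTb f hf S hS h)
  have hle' : ∀ f ∈ FockSupSpace α, fockNorm α p (T f) ≤
      fockSupNorm α f * fockNorm α p fun z => (D z : ℂ) := fun f hf => by
    have e := ENNReal.ofReal_toReal hf.2.ne
    have := hle f hf.1 _ ENNReal.toReal_nonneg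
      (norm_le_of_fockSupNorm_le ENNReal.toReal_nonneg e.ge)
    rwa [e] at this
  have hmap : ∀ f ∈ FockSupSpace α, T f ∈ FockSpace α p := fun f hf =>
    ⟨hTd f hf.1, (hle' f hf).trans_lt (ENNReal.mul_lt_top hf.2 hND)⟩
  refine ⟨⟨hmap, (fockNorm α p fun z => (D z : ℂ)).toNNReal, fun f hf => ?_⟩, hmap,
    fun f M hfM => ?_⟩
  · rw [ENNReal.coe_toNNReal hND.ne, mul_comm]
    exact hle' f hf
  · have hfb : ∀ n z, ‖f n z‖ ≤ (M : ℝ) * Real.exp (α / 2 * ‖z‖ ^ 2) := fun n =>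
      norm_le_of_fockSupNorm_le M.coe_nonneg (by simpa using (hfM n).2)
    obtain ⟨g, hg, φ, hφ, hlim⟩ := exists_subseq_tendsto_of_norm_le (fun n => (hfM n).1.1)
      (B := fun r => M * Real.exp (α / 2 * r ^ 2)) hfb
    have hgb : ∀ z, ‖g z‖ ≤ (M : ℝ) * Real.exp (α / 2 * ‖z‖ ^ 2) := fun z =>
      le_of_tendsto (hlim z).norm (Eventually.of_forall fun n => hfb (φ n) z)
    refine ⟨T g, ⟨hTd g hg, (hle g hg M M.coe_nonneg hgb).trans_lt
      (ENNReal.mul_lt_top ENNReal.ofReal_lt_top hND)⟩, φ, hφ, ?_⟩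
    refine tendsto_fockNorm_sub hp (D := fun z => M * D z)
      (fun n => (hTd _ (hfM (φ n)).1.1).continuous) (hTd g hg).continuous
      (fun n => hTb _ (hfM (φ n)).1.1 M M.coe_nonneg (hfb (φ n))) ?_
      (hTc _ g M M.coe_nonneg (fun n => (hfM (φ n)).1.1) (fun n => hfb (φ n)) hlim)
    have : ∀ z : ℂ, ENNReal.ofReal
        (((M : ℝ) * D z) ^ p * Real.exp (-(α * p / 2) * ‖z‖ ^ 2)) = ENNReal.ofReal ((M : ℝ) ^ p) *
          ENNReal.ofReal (D z ^ p * Real.exp (-(α * p / 2) * ‖z‖ ^ 2)) := fun z => by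
      rw [← ENNReal.ofReal_mul (Real.rpow_nonneg M.coe_nonneg p),
        Real.mul_rpow M.coe_nonneg (hD z), mul_assoc]
    simp_rw [this]
    rw [lintegral_const_mul' _ _ ENNReal.ofReal_ne_top]
    exact ENNReal.mul_lt_top ENNReal.ofReal_lt_top hDint

/-! ### Sufficiency for the two operators -/

theorem compOp_sufficient {α p : ℝ} (hα : 0 < α) (hp : 0 < p) {ψ : ℂ → ℂ}
    (hψ : Differentiable ℂ ψ) {a b : ℂ} (ha : ‖a‖ < 1) (hab : ∀ z, ψ z = a * z + b) :
    IsBoundedFock α p (compOp ψ) ∧ IsCompactFock α p (compOp ψ) := by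
  refine isBoundedFock_and_isCompactFock hp (D := fun z => Real.exp (α / 2 * ‖ψ z‖ ^ 2))
    (fun z => (Real.exp_pos _).le) ?_ (fun f hf => hf.comp hψ) (fun f _ S _ hfS z => hfS (ψ z))
    (fun f g S _ _ _ hlim z => hlim (ψ z))
  -- Half of the gap 1 - |a|² absorbs the cross term of |az + b|²; the other half leaves Gaussian
  -- decay.
  set δ : ℝ := (1 - ‖a‖ ^ 2) / 2 with hδ
  have hδ0 : 0 < δ := by
    have := norm_nonneg a
    rw [hδ]
    nlinarith
  set C : ℝ := ‖a‖ ^ 2 * ‖b‖ ^ 2 / δ + ‖b‖ ^ 2 with hC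
  have hle : ∀ z, ‖ψ z‖ ^ 2 - ‖z‖ ^ 2 ≤ -δ * ‖z‖ ^ 2 + C := by
    intro z
    have h1 : ‖ψ z‖ ≤ ‖a‖ * ‖z‖ + ‖b‖ := by
      rw [hab, ← norm_mul]
      exact norm_add_le _ _
    have h2 : ‖ψ z‖ ^ 2 ≤ (‖a‖ * ‖z‖ + ‖b‖) ^ 2 := by gcongr
    have h3 : 2 * ‖a‖ * ‖b‖ * ‖z‖ ≤ δ * ‖z‖ ^ 2 + ‖a‖ ^ 2 * ‖b‖ ^ 2 / δ := by
      have h4 : 0 ≤ (δ * ‖z‖ - ‖a‖ * ‖b‖) ^ 2 / δ := by positivity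
      have h5 : (δ * ‖z‖ - ‖a‖ * ‖b‖) ^ 2 / δ =
          δ * ‖z‖ ^ 2 + ‖a‖ ^ 2 * ‖b‖ ^ 2 / δ - 2 * ‖a‖ * ‖b‖ * ‖z‖ := by
        field_simp
        ring
      linarith
    have h6 : ‖a‖ ^ 2 = 1 - 2 * δ := by rw [hδ]; ring
    have h7 : (‖a‖ * ‖z‖ + ‖b‖) ^ 2 = (1 - 2 * δ) * ‖z‖ ^ 2 + 2 * ‖a‖ * ‖b‖ * ‖z‖ + ‖b‖ ^ 2 := by
      rw [← h6]; ring
    rw [hC]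
    linarith
  have hint := (GaussianFourier.integrable_cexp_neg_mul_sq_norm_add (V := ℂ)
    (b := ((α * p / 2 * δ : ℝ) : ℂ)) (by rw [Complex.ofReal_re]; positivity) 0 0).2
  rw [hasFiniteIntegral_iff_norm] at hint
  have hn : ∀ z : ℂ, ‖Complex.exp (-((α * p / 2 * δ : ℝ) : ℂ) * (‖z‖ : ℂ) ^ 2
      + 0 * ((inner ℝ (0 : ℂ) z : ℝ) : ℂ))‖ = Real.exp (-(α * p / 2 * δ) * ‖z‖ ^ 2) := fun z => by
    rw [Complex.norm_exp, zero_mul, add_zero, ← Complex.ofReal_neg, ← Complex.ofReal_pow,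
      ← Complex.ofReal_mul, Complex.ofReal_re]
  simp_rw [hn] at hint
  have hbd : ∀ z : ℂ, ENNReal.ofReal (Real.exp (α / 2 * ‖ψ z‖ ^ 2) ^ p *
      Real.exp (-(α * p / 2) * ‖z‖ ^ 2)) ≤ ENNReal.ofReal (Real.exp (α * p / 2 * C)) *
        ENNReal.ofReal (Real.exp (-(α * p / 2 * δ) * ‖z‖ ^ 2)) := fun z => by
    rw [← ENNReal.ofReal_mul (Real.exp_pos _).le, ← Real.exp_mul, ← Real.exp_add, ← Real.exp_add]
    refine ENNReal.ofReal_le_ofReal (Real.exp_le_exp.2 ?_)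
    have := mul_le_mul_of_nonneg_left (hle z) (by positivity : 0 ≤ α * p / 2)
    linarith
  refine (lintegral_mono hbd).trans_lt ?_
  rw [lintegral_const_mul' _ _ ENNReal.ofReal_ne_top]
  exact ENNReal.mul_lt_top ENNReal.ofReal_lt_top hint

/-- The integrand concentrates near t = 1. For r ≥ 1, t² ≤ t makes the exponent linear in t and
integration gains 1/(βr²); for r ≤ 1 the maximum of the integrand suffices. -/
theorem mul_integral_exp_le {β : ℝ} (hβ : 0 < β) {r : ℝ} (hr : 0 ≤ r) :
    r * ∫ t in (0 : ℝ)..1, Real.exp (β * (t * r) ^ 2) ≤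
      Real.exp (β * r ^ 2) * ((2 + 2 / β) / (1 + r)) := by
  have hcont : ∀ g : ℝ → ℝ, Continuous g → IntervalIntegrable g volume 0 1 :=
    fun g hg => hg.intervalIntegrable 0 1
  rcases le_total r 1 with h1 | h1
  · have h2 : ∫ t in (0 : ℝ)..1, Real.exp (β * (t * r) ^ 2) ≤ ∫ _ in (0 : ℝ)..1,
        Real.exp (β * r ^ 2) := by
      refine intervalIntegral.integral_mono_on zero_le_one (hcont _ (by fun_prop))
        (hcont _ (by fun_prop)) fun t ht => ?_
      have : t * r ≤ 1 * r := by gcongr; exact ht.2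
      have h0 : 0 ≤ t * r := mul_nonneg ht.1 hr
      gcongr
      linarith
    rw [intervalIntegral.integral_const, sub_zero, one_smul] at h2
    have h3 : r ≤ (2 + 2 / β) / (1 + r) := by
      rw [le_div_iff₀ (by positivity)]
      have : 0 < 2 / β := by positivity
      nlinarith
    calc _ ≤ r * Real.exp (β * r ^ 2) := by gcongr
      _ ≤ _ := by rw [mul_comm]; gcongr
  · have hr0 : 0 < r := one_pos.trans_le h1
    have hκ : 0 < β * r ^ 2 := by positivity
    have h2 : ∫ t in (0 : ℝ)..1, Real.exp (β * (t * r) ^ 2) ≤ ∫ t in (0 : ℝ)..1,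
        Real.exp (t * (β * r ^ 2)) := by
      refine intervalIntegral.integral_mono_on zero_le_one (hcont _ (by fun_prop))
        (hcont _ (by fun_prop)) fun t ht => Real.exp_le_exp.2 ?_
      have : t ^ 2 ≤ t := by nlinarith [ht.1, ht.2]
      have := mul_le_mul_of_nonneg_right this hκ.le
      linarith [mul_pow t r 2, show β * (t * r) ^ 2 = t ^ 2 * (β * r ^ 2) by ring]
    rw [intervalIntegral.integral_comp_mul_right (fun x => Real.exp x) hκ.ne', integral_exp,
      zero_mul, one_mul, Real.exp_zero, smul_eq_mul] at h2
    calc _ ≤ r * ((β * r ^ 2)⁻¹ * (Real.exp (β * r ^ 2) - 1)) := by gcongr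
      _ ≤ r * ((β * r ^ 2)⁻¹ * Real.exp (β * r ^ 2)) := by gcongr; linarith
      _ = Real.exp (β * r ^ 2) * (1 / (β * r)) := by field_simp
      _ ≤ _ := by
        refine mul_le_mul_of_nonneg_left ?_ (Real.exp_pos _).le
        rw [div_le_div_iff₀ (by positivity) (by positivity)]
        have : (2 + 2 / β) * (β * r) = 2 * β * r + 2 * r := by field_simp
        rw [this]
        nlinarith [mul_pos hβ hr0]

/-- The weighted p-th power of the majorant is a multiple of (1 + |z|)^{-p}, integrable over the
real two-dimensional plane when p > 2; for a = 0 the majorant vanishes. -/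
theorem volterraOp_sufficient {α p : ℝ} (hα : 0 < α) (hp : 0 < p) {g : ℂ → ℂ}
    (hg : Differentiable ℂ g) {a : ℂ} (hga : ∀ z, deriv g z = a) (hap : a = 0 ∨ 2 < p) :
    IsBoundedFock α p (volterraOp g) ∧ IsCompactFock α p (volterraOp g) := by
  have hβ : 0 < α / 2 := by positivity
  set c : ℝ := 2 + 2 / (α / 2) with hc
  have hc0 : 0 < c := by positivity
  refine isBoundedFock_and_isCompactFock hp
    (D := fun z => ‖a‖ * (Real.exp (α / 2 * ‖z‖ ^ 2) * (c / (1 + ‖z‖))))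
    (fun z => by positivity) ?_
    (fun f hf z => (hasDerivAt_volterraOp hg hf z).differentiableAt) ?_ ?_
  · have he : ∀ z : ℂ, ENNReal.ofReal ((‖a‖ * (Real.exp (α / 2 * ‖z‖ ^ 2) * (c / (1 + ‖z‖)))) ^ p *
        Real.exp (-(α * p / 2) * ‖z‖ ^ 2)) =
        ENNReal.ofReal ((‖a‖ * c) ^ p) * ENNReal.ofReal ((1 + ‖z‖) ^ (-p)) := fun z => by
      have hz : 0 < 1 + ‖z‖ := by positivity
      rw [← ENNReal.ofReal_mul (by positivity), Real.rpow_neg hz.le, ← Real.inv_rpow hz.le,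
        ← Real.mul_rpow (by positivity) (by positivity),
        show ‖a‖ * (Real.exp (α / 2 * ‖z‖ ^ 2) * (c / (1 + ‖z‖))) =
          ‖a‖ * c * (1 + ‖z‖)⁻¹ * Real.exp (α / 2 * ‖z‖ ^ 2) by ring,
        Real.mul_rpow (by positivity) (by positivity), mul_assoc, ← Real.exp_mul, ← Real.exp_add,
        show α / 2 * ‖z‖ ^ 2 * p + -(α * p / 2) * ‖z‖ ^ 2 = 0 by ring, Real.exp_zero, mul_one]
    simp_rw [he]
    rw [lintegral_const_mul' _ _ ENNReal.ofReal_ne_top]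
    rcases hap with ha | hp2
    · simp [ha, Real.zero_rpow hp.ne']
    · refine ENNReal.mul_lt_top ENNReal.ofReal_lt_top (finite_integral_one_add_norm ?_)
      rw [Complex.finrank_real_complex]
      exact_mod_cast hp2
  · intro f hf S hS hfS z
    have hb : ∀ t : ℝ, ‖f (t * z) * deriv g (t * z) * z‖ ≤
        S * ‖a‖ * ‖z‖ * Real.exp (α / 2 * (t * ‖z‖) ^ 2) := fun t => by
      rw [norm_mul, norm_mul, hga]
      have := hfS (t * z)
      rw [norm_mul, Complex.norm_real, mul_pow, Real.norm_eq_abs, sq_abs, ← mul_pow] at this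
      calc ‖f (t * z)‖ * ‖a‖ * ‖z‖
          ≤ S * Real.exp (α / 2 * (t * ‖z‖) ^ 2) * ‖a‖ * ‖z‖ := by gcongr
        _ = _ := by ring
    have h1 := intervalIntegral.norm_integral_le_of_norm_le (a := (0 : ℝ)) (b := 1) (μ := volume)
      zero_le_one (ae_of_all _ fun t _ => hb t) (Continuous.intervalIntegrable (by fun_prop) 0 1)
    rw [intervalIntegral.integral_const_mul] at h1
    refine h1.trans ?_
    have h2 := mul_le_mul_of_nonneg_left (mul_integral_exp_le hβ (norm_nonneg z))
      (by positivity : 0 ≤ S * ‖a‖)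
    rw [mul_assoc (S * ‖a‖)]
    refine h2.trans_eq ?_
    ring
  · intro f h S hS hf hfS hlim z
    refine intervalIntegral.tendsto_integral_filter_of_dominated_convergence
      (fun t => S * Real.exp (α / 2 * (t * ‖z‖) ^ 2) * ‖a‖ * ‖z‖)
      (Eventually.of_forall fun n => ?_) (Eventually.of_forall fun n => ae_of_all _ fun t _ => ?_)
      (Continuous.intervalIntegrable (by fun_prop) 0 1) (ae_of_all _ fun t _ => ?_)
    · simp_rw [hga]
      have h4 : Continuous fun t : ℝ => (t : ℂ) * z := by fun_prop
      exact ((((hf n).continuous.comp h4).mul continuous_const).mul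
        continuous_const).aestronglyMeasurable
    · rw [norm_mul, norm_mul, hga]
      have := hfS n (t * z)
      rw [norm_mul, Complex.norm_real, mul_pow, Real.norm_eq_abs, sq_abs, ← mul_pow] at this
      gcongr
    · exact ((hlim (t * z)).mul_const _).mul_const _

/-! ### The equivalences -/

theorem corollary2p5 (α : ℝ) (hα : 0 < α) (p : ℝ) (hp : 0 < p)
    (g ψ : ℂ → ℂ) (hg : Differentiable ℂ g) (hψ : Differentiable ℂ ψ) :
    ((IsBoundedFock α p (volterraOp g) ↔
        (∃ b : ℂ, ∀ z, g z = b) ∨ ((∃ a b : ℂ, ∀ z, g z = a * z + b) ∧ 2 < p)) ∧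
      (IsCompactFock α p (volterraOp g) ↔
        (∃ b : ℂ, ∀ z, g z = b) ∨ ((∃ a b : ℂ, ∀ z, g z = a * z + b) ∧ 2 < p))) ∧
    ((IsBoundedFock α p (compOp ψ) ↔
        ∃ a b : ℂ, ‖a‖ < 1 ∧ ∀ z, ψ z = a * z + b) ∧
      (IsCompactFock α p (compOp ψ) ↔
        ∃ a b : ℂ, ‖a‖ < 1 ∧ ∀ z, ψ z = a * z + b)) := by
  have hV : (∃ b : ℂ, ∀ z, g z = b) ∨ ((∃ a b : ℂ, ∀ z, g z = a * z + b) ∧ 2 < p) →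
      IsBoundedFock α p (volterraOp g) ∧ IsCompactFock α p (volterraOp g) := by
    rintro (⟨b, hb⟩ | ⟨⟨a, b, hab⟩, hp2⟩)
    · refine volterraOp_sufficient hα hp hg (a := 0) (fun z => ?_) (Or.inl rfl)
      rw [funext hb, deriv_const]
    · refine volterraOp_sufficient hα hp hg (a := a) (fun z => ?_) (Or.inr hp2)
      rw [funext hab]
      simp
  have hC : (∃ a b : ℂ, ‖a‖ < 1 ∧ ∀ z, ψ z = a * z + b) →
      IsBoundedFock α p (compOp ψ) ∧ IsCompactFock α p (compOp ψ) := by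
    rintro ⟨a, b, ha, hab⟩
    exact compOp_sufficient hα hp hψ ha hab
  exact ⟨⟨⟨fun h => volterraOp_necessary hα hp hg h.1, fun h => (hV h).1⟩,
      ⟨fun h => volterraOp_necessary hα hp hg h.1, fun h => (hV h).2⟩⟩,
    ⟨⟨fun h => compOp_necessary hα hp hψ h.1, fun h => (hC h).1⟩,
      ⟨fun h => compOp_necessary hα hp hψ h.1, fun h => (hC h).2⟩⟩⟩
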